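/- Let $M$ be a complex manifold of complex dimension $n$ with complex structure $J$, and let $g$ be a (positive-definite) Kähler metric on $M$ with closed fundamental form $\Phi(X,Y)=g(X,JY)$. Let $\nabla$ be a rigid special Kähler structure on $M$, i.e. a real, flat, torsion-free connection on $TM$ with $\nabla\Phi=0$ and $d_\nabla J=0$, where $(d_\nabla J)(X,Y)=\nabla_X(JY)-\nabla_Y(JX)-J[X,Y]$. Let $(x^1,\dots,x^n,y_1,\dots,y_n)$ be any flat Darboux coordinate system on an open set $U\subseteq M$: $\Phi=\sum_j dx^j\wedge dy_j$ (that is, $\Phi(\partial_{x^i},\partial_{y_j})=\delta_{ij}$ and $\Phi(\partial_{x^i},\partial_{x^j})=\Phi(\partial_{y_i},\partial_{y_j})=0$) and $\nabla\partial_{x^j}=\nabla\partial_{y_j}=0$. Let $\pi^{(1,0)}=\frac12(1-iJ)$ be the projector onto the vectors of type $(1,0)$. Around each point of $U$ there are smooth complex functions $\eta^j,\lambda_j$ ($1\le j\le n$) such that the complex vector field $\chi=\frac12\sum_j\big(\eta^j\,\partial_{x^j}-\lambda_j\,\partial_{y_j}\big)$ satisfies $\nabla\chi=\pi^{(1,0)}$.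 Moreover, for every open $V\subseteq U$ and all smooth $\eta^j,\lambda_j:V\to\mathbb C$ with this property: 1. $\eta^j$ and $\lambda_j$ are holomorphic on $V$. 2. In any holomorphic coordinates $z^1,\dots,z^n$, write $d\eta^j=\sum_l\alpha^j{}_l\,dz^l$ and $d\lambda_j=\sum_l\beta_{jl}\,dz^l$. Then the $n\times n$ matrices $\alpha$ and $\beta$ both have rank $n$ at every point of $V$ where the coordinates are defined. 3. Consequently $\{\eta^j\}$ is a system of local holomorphic coordinates near every point of $V$, and so is $\{\lambda_j\}$. 4. Every point of $V$ has a connected open neighbourhood on which the $\eta^j$ are holomorphic coordinates and on which there is a holomorphic function $\mathcal F$ of $\eta=(\eta^1,\dots,\eta^n)$ (the prepotential), determined up to an additive constant by the first of the following equations, with $$\lambda_j=-8\,\frac{\partial\mathcal F}{\partial\eta^j},\qquad \frac{\partial\lambda_j}{\partial\eta^i}=-8\,\frac{\partial^2\mathcal F}{\partial\eta^i\,\partial\eta^j}.$$ -/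

import Mathlib

open scoped Manifold ContDiff Bundle TensorProduct

noncomputable section

namespace SpecialKahler

/-- A complex manifold modelled on `ℂⁿ` is a real manifold: complex analytic transition maps are
real analytic. -/
instance realManifold {n : ℕ} {M : Type*} [TopologicalSpace M] [ChartedSpace (Fin n → ℂ) M]
    [h : IsManifold 𝓘(ℂ, Fin n → ℂ) ω M] : IsManifold 𝓘(ℝ, Fin n → ℂ) ω M := by
  refine isManifold_of_contDiffOn _ _ _ ?_
  intro e e' he he'
  have h1 := (contDiffGroupoid ω 𝓘(ℂ, Fin n → ℂ)).compatible he he'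
  rw [contDiffGroupoid, mem_groupoid_of_pregroupoid] at h1
  exact ContDiffOn.restrict_scalars ℝ h1.1

variable {n : ℕ} {M : Type*} [TopologicalSpace M] [ChartedSpace (Fin n → ℂ) M]

/-- The real tangent space `T_p M` of the complex manifold `M`. -/
abbrev RTangent (n : ℕ) {M : Type*} [TopologicalSpace M] [ChartedSpace (Fin n → ℂ) M]
    (p : M) : Type :=
  TangentSpace 𝓘(ℝ, Fin n → ℂ) p

/-- A (rough, real) vector field on `M`. -/
abbrev VField (n : ℕ) (M : Type*) [TopologicalSpace M] [ChartedSpace (Fin n → ℂ) M] :=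
  Π p : M, RTangent n p

/-- The complex structure `J : T_p M → T_p M`, multiplication by `i` in the tangent space. The
identification of `T_p M` with `ℂⁿ` is the one through a holomorphic chart at `p`, and the
transition maps have complex linear derivatives, so this does not depend on the chart. -/
def J (p : M) : RTangent n p →L[ℝ] RTangent n p :=
  (Complex.I • ContinuousLinearMap.id ℝ (Fin n → ℂ) : (Fin n → ℂ) →L[ℝ] (Fin n → ℂ))

section Geometry

variable [IsManifold 𝓘(ℂ, Fin n → ℂ) ω M]

/-- The vector field `X` is differentiable at `p`. -/
def DiffAt (X : VField n M) (p : M) : Prop :=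
  MDifferentiableAt 𝓘(ℝ, Fin n → ℂ) (𝓘(ℝ, Fin n → ℂ).prod 𝓘(ℝ, Fin n → ℂ))
    (fun q => (⟨q, X q⟩ : TangentBundle 𝓘(ℝ, Fin n → ℂ) M)) p

/-- The vector field `X` is smooth at `p`. -/
def SmoothAt (X : VField n M) (p : M) : Prop :=
  ContMDiffAt 𝓘(ℝ, Fin n → ℂ) (𝓘(ℝ, Fin n → ℂ).prod 𝓘(ℝ, Fin n → ℂ)) ∞
    (fun q => (⟨q, X q⟩ : TangentBundle 𝓘(ℝ, Fin n → ℂ) M)) p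

/-- The Lie bracket of vector fields. -/
abbrev bracket (X Y : VField n M) : VField n M :=
  VectorField.mlieBracket 𝓘(ℝ, Fin n → ℂ) X Y

/-- The derivative `df : T_p M → ℝ` of a real function. -/
abbrev dR (f : M → ℝ) (p : M) : RTangent n p →L[ℝ] ℝ :=
  mvfderiv 𝓘(ℝ, Fin n → ℂ) f p

/-- A linear connection on `M` (in the real tangent bundle); `cov Y p (X p)` is `(∇_X Y)(p)`. -/
abbrev Connection (n : ℕ) (M : Type*) [TopologicalSpace M] [ChartedSpace (Fin n → ℂ) M]
    [IsManifold 𝓘(ℂ, Fin n → ℂ) ω M] :=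
  CovariantDerivative 𝓘(ℝ, Fin n → ℂ) (Fin n → ℂ) (TangentSpace 𝓘(ℝ, Fin n → ℂ) : M → Type _)

/-- The curvature `R(X,Y)Z = ∇_X ∇_Y Z - ∇_Y ∇_X Z - ∇_[X,Y] Z`. -/
def curvature (cov : Connection n M) (X Y Z : VField n M) (p : M) : RTangent n p :=
  cov (fun q => cov Z q (Y q)) p (X p) - cov (fun q => cov Z q (X q)) p (Y p)
    - cov Z p (bracket X Y p)

/-- The connection is flat: its curvature vanishes on all (local) smooth vector fields. -/
def IsFlat (cov : Connection n M) : Prop :=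
  ∀ (X Y Z : VField n M) (p : M), SmoothAt X p → SmoothAt Y p → SmoothAt Z p →
    curvature cov X Y Z p = 0

/-- The covariant exterior differential of a 1-form `F` with values in the tangent bundle,
`(d_∇ F)(X,Y) = ∇_X (F Y) - ∇_Y (F X) - F [X,Y]`. -/
def covExtDeriv (cov : Connection n M) (F : Π p : M, RTangent n p →L[ℝ] RTangent n p)
    (X Y : VField n M) (p : M) : RTangent n p :=
  cov (fun q => F q (Y q)) p (X p) - cov (fun q => F q (X q)) p (Y p) - F p (bracket X Y p)

/-- A Kähler metric (positive definite): a smooth Riemannian metric `g` with `g(JX,JY) = g(X,Y)`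
and closed fundamental form `Φ(X,Y) = g(X,JY)`. The last field is `dΦ(X,Y,Z) = 0`. -/
structure KahlerMetric (n : ℕ) (M : Type*) [TopologicalSpace M] [ChartedSpace (Fin n → ℂ) M]
    [IsManifold 𝓘(ℂ, Fin n → ℂ) ω M] where
  g : Bundle.ContMDiffRiemannianMetric 𝓘(ℝ, Fin n → ℂ) ∞ (Fin n → ℂ)
    (TangentSpace 𝓘(ℝ, Fin n → ℂ) : M → Type _)
  hermitian : ∀ (p : M) (v w : RTangent n p), g.inner p (J p v) (J p w) = g.inner p v w
  closed : ∀ (X Y Z : VField n M) (p : M), DiffAt X p → DiffAt Y p → DiffAt Z p →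
    dR (fun q => g.inner q (Y q) (J q (Z q))) p (X p)
      - dR (fun q => g.inner q (X q) (J q (Z q))) p (Y p)
      + dR (fun q => g.inner q (X q) (J q (Y q))) p (Z p)
      - g.inner p (bracket X Y p) (J p (Z p))
      + g.inner p (bracket X Z p) (J p (Y p))
      - g.inner p (bracket Y Z p) (J p (X p)) = 0

/-- The fundamental (Kähler) form `Φ(v,w) = g(v,Jw)`. -/
def KahlerMetric.form (K : KahlerMetric n M) (p : M) (v w : RTangent n p) : ℝ :=
  K.g.inner p v (J p w)

/-- A special Kähler structure on the Kähler manifold `(M, K)`: a smooth real, flat, torsionfree,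
symplectic (`∇Φ = 0`) connection with `d_∇ J = 0`. -/
structure SpecialStructure (K : KahlerMetric n M) where
  conn : Connection n M
  smooth : CovariantDerivative.ContMDiffCovariantDerivative conn ∞
  flat : IsFlat conn
  torsionFree : conn.torsion = 0
  symplectic : ∀ (X Y Z : VField n M) (p : M), DiffAt X p → DiffAt Y p → DiffAt Z p →
    dR (fun q => K.form q (Y q) (Z q)) p (X p)
      = K.form p (conn Y p (X p)) (Z p) + K.form p (Y p) (conn Z p (X p))
  special : ∀ (X Y : VField n M) (p : M), DiffAt X p → DiffAt Y p →
    covExtDeriv conn J X Y p = 0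

/-- The coordinate vector field `∂/∂x^j` of a system of coordinates `(x^1..x^n, y_1..y_n)`. -/
def dx (e : OpenPartialHomeomorph M ((Fin n → ℝ) × (Fin n → ℝ))) (j : Fin n) : VField n M :=
  VectorField.mpullback 𝓘(ℝ, Fin n → ℂ) 𝓘(ℝ, (Fin n → ℝ) × (Fin n → ℝ)) e
    (fun _ => ((Pi.single j 1, 0) : (Fin n → ℝ) × (Fin n → ℝ)))

/-- The coordinate vector field `∂/∂y_j` of a system of coordinates `(x^1..x^n, y_1..y_n)`. -/
def dy (e : OpenPartialHomeomorph M ((Fin n → ℝ) × (Fin n → ℝ))) (j : Fin n) : VField n M :=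
  VectorField.mpullback 𝓘(ℝ, Fin n → ℂ) 𝓘(ℝ, (Fin n → ℝ) × (Fin n → ℝ)) e
    (fun _ => ((0, Pi.single j 1) : (Fin n → ℝ) × (Fin n → ℝ)))

/-- A flat Darboux coordinate system `(x^j, y_j)` on an open set (the source of `chart`): smooth
coordinates with `Φ = ∑ dx^j ∧ dy_j` whose coordinate vector fields are parallel. -/
structure FlatDarboux {K : KahlerMetric n M} (S : SpecialStructure K) where
  chart : OpenPartialHomeomorph M ((Fin n → ℝ) × (Fin n → ℝ))
  smooth : ContMDiffOn 𝓘(ℝ, Fin n → ℂ) 𝓘(ℝ, (Fin n → ℝ) × (Fin n → ℝ)) ∞ chart chart.source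
  smooth_symm :
    ContMDiffOn 𝓘(ℝ, (Fin n → ℝ) × (Fin n → ℝ)) 𝓘(ℝ, Fin n → ℂ) ∞ chart.symm chart.target
  form_xx : ∀ p ∈ chart.source, ∀ i j, K.form p (dx chart i p) (dx chart j p) = 0
  form_yy : ∀ p ∈ chart.source, ∀ i j, K.form p (dy chart i p) (dy chart j p) = 0
  form_xy : ∀ p ∈ chart.source, ∀ i j,
    K.form p (dx chart i p) (dy chart j p) = if i = j then 1 else 0
  parallel_x : ∀ p ∈ chart.source, ∀ j, S.conn (dx chart j) p = 0
  parallel_y : ∀ p ∈ chart.source, ∀ j, S.conn (dy chart j) p = 0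

/-- The complexified tangent space. -/
abbrev CTangent (n : ℕ) {M : Type*} [TopologicalSpace M] [ChartedSpace (Fin n → ℂ) M]
    (p : M) : Type :=
  ℂ ⊗[ℝ] RTangent n p

/-- The real part of a complex tangent vector. -/
def rePart (p : M) : CTangent n p →ₗ[ℝ] RTangent n p :=
  (TensorProduct.lid ℝ (RTangent n p)).toLinearMap ∘ₗ
    LinearMap.rTensor (RTangent n p) Complex.reLm

/-- The imaginary part of a complex tangent vector. -/
def imPart (p : M) : CTangent n p →ₗ[ℝ] RTangent n p :=
  (TensorProduct.lid ℝ (RTangent n p)).toLinearMap ∘ₗ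
    LinearMap.rTensor (RTangent n p) Complex.imLm

/-- The complex linear extension of a real connection to complex vector fields,
`∇_X (A + iB) = ∇_X A + i ∇_X B`, at the point `p` in the direction of `v`. -/
def nablaC (cov : Connection n M) (χ : Π p : M, CTangent n p) (p : M) (v : RTangent n p) :
    CTangent n p :=
  (1 : ℂ) ⊗ₜ[ℝ] cov (fun q => rePart q (χ q)) p v
    + Complex.I ⊗ₜ[ℝ] cov (fun q => imPart q (χ q)) p v

/-- The projector `π^(1,0) v = (v - i J v) / 2` onto the vectors of type `(1,0)`. -/
def piHol (p : M) (v : RTangent n p) : CTangent n p :=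
  (1 / 2 : ℂ) • ((1 : ℂ) ⊗ₜ[ℝ] v - Complex.I ⊗ₜ[ℝ] (J p v))

/-- The complex vector field `χ = (1/2) (η^i ∂/∂x^i - lam_i ∂/∂y_i)`. -/
def symplecticSection (e : OpenPartialHomeomorph M ((Fin n → ℝ) × (Fin n → ℝ)))
    (η lam : Fin n → M → ℂ) (p : M) : CTangent n p :=
  (1 / 2 : ℂ) • ∑ i, ((η i p) ⊗ₜ[ℝ] (dx e i p) - (lam i p) ⊗ₜ[ℝ] (dy e i p))

/-- `η, lam` are (on `V`) the components, in the flat Darboux system `D`, of a smooth complex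
vector field `χ` with `∇χ = π^(1,0)`. -/
structure IsSpecialPair {K : KahlerMetric n M} {S : SpecialStructure K} (D : FlatDarboux S)
    (V : Set M) (η lam : Fin n → M → ℂ) : Prop where
  smooth_eta : ∀ j, ContMDiffOn 𝓘(ℝ, Fin n → ℂ) 𝓘(ℝ, ℂ) ∞ (η j) V
  smooth_lam : ∀ j, ContMDiffOn 𝓘(ℝ, Fin n → ℂ) 𝓘(ℝ, ℂ) ∞ (lam j) V
  nabla_eq : ∀ p ∈ V, ∀ v : RTangent n p,
    nablaC S.conn (symplecticSection D.chart η lam) p v = piHol p v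

/-- The functions `f_1..f_n` are holomorphic on `V`. -/
def Holomorphic (V : Set M) (f : Fin n → M → ℂ) : Prop :=
  ∀ j, MDifferentiableOn 𝓘(ℂ, Fin n → ℂ) 𝓘(ℂ, ℂ) (f j) V

/-- The matrix `a` with `df_j = ∑ a_{jl} dz^l` at `p`, in the holomorphic coordinates `z`. -/
def jacobian (z : OpenPartialHomeomorph M (Fin n → ℂ)) (f : Fin n → M → ℂ) (p : M) :
    Matrix (Fin n) (Fin n) ℂ :=
  Matrix.of fun j l => fderiv ℂ (fun w => f j (z.symm w)) (z p) (Pi.single l 1)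

/-- `e` is a holomorphic chart of `M` inside `V` whose coordinate functions are `f_1..f_n`. -/
structure IsHolChart (V : Set M) (f : Fin n → M → ℂ) (e : OpenPartialHomeomorph M (Fin n → ℂ)) :
    Prop where
  mem_atlas : e ∈ IsManifold.maximalAtlas 𝓘(ℂ, Fin n → ℂ) ω M
  subset : e.source ⊆ V
  eq : ∀ q ∈ e.source, ∀ j, e q j = f j q

/-- `f_1..f_n` are local holomorphic coordinates around each point of `V`. -/
def AreHolCoordinates (V : Set M) (f : Fin n → M → ℂ) : Prop :=
  ∀ p ∈ V, ∃ e, IsHolChart V f e ∧ p ∈ e.source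

/-- `F` is a holomorphic function of the coordinates `e` with `lam_j = -8 ∂F/∂e^j`. -/
structure IsPrepotential (e : OpenPartialHomeomorph M (Fin n → ℂ)) (lam : Fin n → M → ℂ)
    (F : (Fin n → ℂ) → ℂ) : Prop where
  holomorphic : DifferentiableOn ℂ F e.target
  eq : ∀ q ∈ e.source, ∀ j, lam j q = -8 * fderiv ℂ F (e q) (Pi.single j 1)

end Geometry

end SpecialKahler

end

/-! In a flat Darboux frame `∇` is differentiation of components. With `(x, y)` the coordinates, `∇χ
= π^(1,0)` therefore says exactly that `dη^j = dx^j ∘ (1 - iJ)` and `dλ_j = -dy_j ∘ (1 - iJ)`.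
Everything follows from these two formulas (`IsSpecialPair.mvfderiv_eq`).

Existence: the real parts are the coordinates themselves. The imaginary parts are primitives of
`-dx^j ∘ J` and `dy_j ∘ J`, and these forms are closed because `d_∇ J = 0` and the coordinate fields
commute. The Poincaré lemma on a ball finishes (`FlatDarboux.exists_isSpecialPair`).

Holomorphy: `(1 - iJ)J = i(1 - iJ)`, so the differentials are complex linear. Rank: if all `dη^j`
kill `v`, then `dx` kills both `v` and `Jv`; but `{dx = 0}` is Lagrangian, so `g(v,v) = -Φ(v,Jv) =
0`. The same works with `dy`. The inverse function theorem then yields holomorphic charts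
(`exists_isHolChart`).

Prepotential: `Φ` is `J`-invariant, and the real and imaginary parts of this invariance say `∑ dλ_j
∧ dη^j = 0`. Hence `∑ λ_j dη^j` is closed, and on a ball in the coordinates `η` it equals `-8 dF`.

Since charts in the maximal atlas have to be analytic, it is also shown that a smooth map with
complex linear derivative is analytic in several variables. -/

noncomputable section

namespace SpecialKahler

/-! ### Analyticity of complex differentiable maps in several variables. -/

section ComplexAnalysis

variable {E F : Type*} [NormedAddCommGroup E] [NormedSpace ℂ E]
  [NormedAddCommGroup F] [NormedSpace ℂ F]

/-- A real differentiable map whose derivative commutes with `i` is complex differentiable. -/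
theorem differentiableAt_complex_of_fderiv_I_smul {f : E → F} {x : E}
    (hf : DifferentiableAt ℝ f x)
    (h : ∀ v, fderiv ℝ f x (Complex.I • v) = Complex.I • fderiv ℝ f x v) :
    DifferentiableAt ℂ f x := by
  refine (differentiableAt_iff_restrictScalars ℝ hf).2 ⟨⟨⟨⟨fderiv ℝ f x, ?_⟩, ?_⟩, ?_⟩, ?_⟩
  · exact fun u v => map_add _ u v
  · intro c v
    have hc : ∀ {G : Type _} [NormedAddCommGroup G] [NormedSpace ℂ G] (w : G),
        c • w = c.re • w + c.im • Complex.I • w := by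
      intro G _ _ w
      conv_lhs => rw [← Complex.re_add_im c]
      rw [add_smul, mul_smul, Complex.coe_smul, Complex.coe_smul]
    have hc' : c • fderiv ℝ f x v
        = c.re • fderiv ℝ f x v + c.im • Complex.I • fderiv ℝ f x v := by
      conv_lhs => rw [← Complex.re_add_im c]
      rw [add_smul, mul_smul, Complex.coe_smul, Complex.coe_smul]
    simp only [RingHom.id_apply]
    rw [hc v, hc', map_add, map_smul, map_smul, h]
  · exact (fderiv ℝ f x).continuous
  · ext v; rfl

/-- A complex differentiable map that is smooth in the real sense is smooth in the complex sense. -/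
theorem contDiffOn_complex_of_real [FiniteDimensional ℂ E] {U : Set E} (hU : IsOpen U) (k : ℕ)
    {f : E → F} (hr : ContDiffOn ℝ ∞ f U) (hc : DifferentiableOn ℂ f U) :
    ContDiffOn ℂ k f U := by
  induction k generalizing f with
  | zero => exact contDiffOn_zero.2 hc.continuousOn
  | succ k ih =>
    have hf' : ∀ x ∈ U, fderiv ℝ f x = (fderiv ℂ f x).restrictScalars ℝ := fun x hx =>
      (hc.differentiableAt (hU.mem_nhds hx)).fderiv_restrictScalars ℝ
    -- In finite dimension it suffices to treat each directional derivative `f'(·)v`, and this again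
    -- satisfies both hypotheses of the induction.
    have key : ContDiffOn ℂ k (fderiv ℂ f) U := by
      refine contDiffOn_clm_apply.2 fun v => ih ?_ ?_
      · refine (((contDiffOn_infty_iff_fderiv_of_isOpen hU).1 hr).2.clm_apply
          (contDiffOn_const (c := v))).congr fun x hx => ?_
        rw [hf' x hx]; rfl
      · intro x hx
        have hrx : ContDiffAt ℝ ∞ f x := hr.contDiffAt (hU.mem_nhds hx)
        have hd : DifferentiableAt ℝ (fderiv ℝ f) x :=
          (hrx.fderiv_right (m := 1) (by norm_cast)).differentiableAt one_ne_zero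
        have hsymm : IsSymmSndFDerivAt ℝ f x :=
          hrx.isSymmSndFDerivAt (by simp [minSmoothness_of_isRCLikeNormedField]; norm_cast)
        have hev : (fun y => fderiv ℂ f y v) =ᶠ[nhds x] fun y => fderiv ℝ f y v := by
          filter_upwards [hU.mem_nhds hx] with y hy
          rw [hf' y hy]; rfl
        have hdv : DifferentiableAt ℝ (fun y => fderiv ℝ f y v) x :=
          hd.clm_apply (differentiableAt_const v)
        have hfd : ∀ w, fderiv ℝ (fun y => fderiv ℝ f y v) x w
            = fderiv ℝ (fun y => fderiv ℝ f y w) x v := by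
          intro w
          rw [fderiv_clm_apply hd (differentiableAt_const v),
            fderiv_clm_apply hd (differentiableAt_const w)]
          simpa using hsymm w v
        refine (DifferentiableAt.congr_of_eventuallyEq ?_ hev).differentiableWithinAt
        -- By symmetry of the second derivative, differentiating `f'(·)v` along `iw` is
        -- differentiating `f'(·)(iw) = i f'(·)w` along `v`.
        refine differentiableAt_complex_of_fderiv_I_smul hdv fun w => ?_
        rw [hfd, hfd]
        have hI : (fun y => fderiv ℝ f y (Complex.I • w)) =ᶠ[nhds x]
            fun y => Complex.I • fderiv ℝ f y w := by
          filter_upwards [hU.mem_nhds hx] with y hy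
          rw [hf' y hy]; simp
        rw [hI.fderiv_eq]
        have := ((hd.clm_apply (differentiableAt_const w)).hasFDerivAt.const_smul Complex.I).fderiv
        erw [this]; rfl
    push_cast
    exact (contDiffOn_succ_iff_fderiv_of_isOpen hU).2 ⟨hc, by simp, key⟩

/-- Restriction to complex lines reduces convergence of the Taylor series to the one-variable
theorem. -/
theorem iteratedDeriv_line {f : E → F} {U : Set E} (hU : IsOpen U) (hf : ∀ k : ℕ, ContDiffOn ℂ k f U)
    (x y : E) (k : ℕ) (t : ℂ) (ht : x + t • y ∈ U) :
    iteratedDeriv k (fun s : ℂ => f (x + s • y)) t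
      = iteratedFDeriv ℂ k f (x + t • y) (fun _ => y) := by
  induction k generalizing t with
  | zero => simp
  | succ k ih =>
    have hline : Continuous fun s : ℂ => x + s • y := by fun_prop
    have hev : iteratedDeriv k (fun s : ℂ => f (x + s • y)) =ᶠ[nhds t]
        fun s => iteratedFDeriv ℂ k f (x + s • y) (fun _ => y) := by
      filter_upwards [hline.continuousAt.preimage_mem_nhds (hU.mem_nhds ht)] with s hs
      exact ih s hs
    have hd : DifferentiableAt ℂ (iteratedFDeriv ℂ k f) (x + t • y) :=
      ((hf (k + 1)).contDiffAt (hU.mem_nhds ht)).differentiableAt_iteratedFDeriv (by norm_cast; simp)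
    have hl : HasDerivAt (fun s : ℂ => x + s • y) y t := by
      simpa using ((hasDerivAt_id t).smul_const y).const_add x
    have h1 := hd.hasFDerivAt.comp_hasDerivAt t hl
    have h2 := ((ContinuousMultilinearMap.apply ℂ (fun _ : Fin k => E) F
      (fun _ => y)).hasFDerivAt).comp_hasDerivAt t h1
    rw [iteratedDeriv_succ, hev.deriv_eq, iteratedFDeriv_succ_apply_left]
    exact h2.deriv

/-- Iterated Cauchy estimates. -/
theorem norm_iteratedFDeriv_le_of_bound {f : E → F} {x : E} {R C : ℝ} (hR : 0 < R)
    (hf : ∀ k : ℕ, ContDiffOn ℂ k f (Metric.ball x R)) (hC : ∀ y ∈ Metric.ball x R, ‖f y‖ ≤ C)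
    (k : ℕ) : ‖iteratedFDeriv ℂ k f x‖ ≤ C * (2 * k / R) ^ k := by
  rcases Nat.eq_zero_or_pos k with rfl | hk
  · simpa using hC x (Metric.mem_ball_self hR)
  have hk' : (0 : ℝ) < k := by exact_mod_cast hk
  have hC0 : 0 ≤ C := (norm_nonneg _).trans (hC x (Metric.mem_ball_self hR))
  -- The radius is spent in `k` equal steps: the `j`-th derivative is bounded on the ball of radius
  -- `R - jR/k`, and each Cauchy estimate uses radius `R/k`. At `j = k` that open ball is empty, so
  -- the centre is admitted separately.
  have main : ∀ j : ℕ, j ≤ k → ∀ y, dist y x < R - j * (R / k) ∨ (j = k ∧ y = x) →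
      ‖iteratedFDeriv ℂ j f y‖ ≤ C * (2 * k / R) ^ j := by
    intro j
    induction j with
    | zero =>
      intro _ y hy
      rcases hy with hy | ⟨h, _⟩
      · simpa using hC y (by simpa using hy)
      · omega
    | succ j ih =>
      intro hj y hy
      have hsub : Metric.ball y (R / k) ⊆ {z | dist z x < R - j * (R / k)} := by
        intro z hz
        rw [Metric.mem_ball] at hz
        have htri := dist_triangle z y x
        rcases hy with hy | ⟨h, rfl⟩
        · push_cast at hy
          simp only [Set.mem_ofPred_eq]; linarith
        · have : ((j : ℝ) + 1) = k := by exact_mod_cast h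
          simp only [Set.mem_ofPred_eq]
          have h3 : (k : ℝ) * (R / k) = R := by field_simp
          have h4 : ((j : ℝ) + 1) * (R / k) = R := by rw [this, h3]
          linarith
      have hball : Metric.ball y (R / k) ⊆ Metric.ball x R := by
        intro z hz
        have := hsub hz
        simp only [Set.mem_ofPred_eq] at this
        have h0 : 0 ≤ j * (R / k) := by positivity
        rw [Metric.mem_ball]; linarith
      have hb : ∀ z ∈ Metric.ball y (R / k), ‖iteratedFDeriv ℂ j f z‖ ≤ C * (2 * k / R) ^ j := by
        intro z hz
        have := hsub hz
        exact ih (by omega) z (Or.inl this)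
      have hd : DifferentiableOn ℂ (iteratedFDeriv ℂ j f) (Metric.ball y (R / k)) := fun z hz =>
        (((hf (j + 1)).contDiffAt (Metric.isOpen_ball.mem_nhds
          (hball hz))).differentiableAt_iteratedFDeriv (by norm_cast; simp)).differentiableWithinAt
      have hRk : 0 < R / k := by positivity
      -- The estimate involves the oscillation around the value at `y`, at most twice the bound;
      -- this is the `2` in `2k/R`.
      have := Complex.norm_fderiv_le_div_of_mapsTo_ball (R₂ := 2 * (C * (2 * k / R) ^ j)) hd ?_ hRk
      · rw [norm_fderiv_iteratedFDeriv] at this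
        refine this.trans (le_of_eq ?_)
        rw [pow_succ]; field_simp
      · intro z hz
        rw [mem_closedBall_iff_norm]
        have h1 := hb z hz
        have h2 := hb y (Metric.mem_ball_self hRk)
        have := norm_sub_le (iteratedFDeriv ℂ j f z) (iteratedFDeriv ℂ j f y)
        linarith
  exact main k le_rfl x (Or.inr ⟨rfl, rfl⟩)

/-- A complex smooth map on an open set is analytic. -/
theorem analyticAt_of_contDiffOn_complex [CompleteSpace F] {U : Set E} (hU : IsOpen U) {f : E → F}
    (hf : ∀ k : ℕ, ContDiffOn ℂ k f U) {x : E} (hx : x ∈ U) : AnalyticAt ℂ f x := by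
  obtain ⟨R, hR, hRU, C, hC⟩ : ∃ R > 0, Metric.ball x R ⊆ U ∧ ∃ C, ∀ y ∈ Metric.ball x R, ‖f y‖ ≤ C := by
    have hcont : ContinuousAt f x := (hf 0).continuousOn.continuousAt (hU.mem_nhds hx)
    have hb : ∀ᶠ y in nhds x, ‖f y‖ < ‖f x‖ + 1 :=
      hcont.norm.eventually (gt_mem_nhds (by linarith))
    obtain ⟨R, hR, h⟩ := Metric.eventually_nhds_iff_ball.1 (hb.and (hU.mem_nhds hx))
    exact ⟨R, hR, fun y hy => (h y hy).2, ‖f x‖ + 1, fun y hy => (h y hy).1.le⟩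
  have hf' : ∀ k : ℕ, ContDiffOn ℂ k f (Metric.ball x R) := fun k => (hf k).mono hRU
  have hC0 : 0 ≤ C := (norm_nonneg _).trans (hC x (Metric.mem_ball_self hR))
  let p : FormalMultilinearSeries ℂ E F := fun k => ((k.factorial : ℂ)⁻¹) • iteratedFDeriv ℂ k f x
  -- Since `k^k / k! ≤ e^k`, the Cauchy bounds give `‖p k‖ r^k ≤ C` for exactly this radius.
  let r : NNReal := ⟨R / (2 * Real.exp 1), by positivity⟩
  have hr : (r : ℝ) = R / (2 * Real.exp 1) := rfl
  have hrad : (r : ENNReal) ≤ p.radius := by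
    refine p.le_radius_of_bound C fun k => ?_
    have h1 : ‖p k‖ ≤ (k.factorial : ℝ)⁻¹ * (C * (2 * k / R) ^ k) := by
      simp only [p, norm_smul, norm_inv, Complex.norm_natCast]
      gcongr
      exact norm_iteratedFDeriv_le_of_bound hR hf' hC k
    have h2 : (k : ℝ) ^ k / k.factorial ≤ Real.exp k :=
      Real.pow_div_factorial_le_exp k (by positivity) k
    have h3 : Real.exp k = Real.exp 1 ^ k := by rw [← Real.exp_nat_mul, mul_one]
    calc ‖p k‖ * (r : ℝ) ^ k
        ≤ ((k.factorial : ℝ)⁻¹ * (C * (2 * k / R) ^ k)) * (R / (2 * Real.exp 1)) ^ k := by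
          rw [hr]; gcongr
      _ = C * ((k : ℝ) ^ k / k.factorial) / Real.exp 1 ^ k := by
          have he : Real.exp 1 ≠ 0 := (Real.exp_pos 1).ne'
          simp only [div_pow, mul_pow]; field_simp
      _ ≤ C * Real.exp k / Real.exp 1 ^ k := by gcongr
      _ = C := by rw [h3]; field_simp
  have hr0 : 0 < (r : ℝ) := by rw [hr]; positivity
  refine ⟨p, r, hrad, by exact_mod_cast hr0, ?_⟩
  intro y hy
  have hy' : ‖y‖ < r := by simpa using hy
  -- A disc of radius 2 has `t = 1` in its interior, and `2r = R/e < R` keeps the line inside the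
  -- ball.
  have hmaps : ∀ t ∈ Metric.ball (0 : ℂ) 2, x + t • y ∈ Metric.ball x R := by
    intro t ht
    rw [mem_ball_iff_norm, add_sub_cancel_left, norm_smul]
    have ht' : ‖t‖ < 2 := by simpa using ht
    have h1 : ‖t‖ * ‖y‖ ≤ 2 * r := by gcongr
    have h2 : (2 : ℝ) * r < R := by
      rw [hr]
      have : 1 < Real.exp 1 := by simp
      rw [← mul_div_assoc, div_lt_iff₀ (by positivity)]
      nlinarith
    linarith
  have hd : DifferentiableOn ℂ (fun t : ℂ => f (x + t • y)) (Metric.ball 0 2) := by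
    refine ((hf' 1).differentiableOn one_ne_zero).comp (t := Metric.ball x R) ?_ hmaps
    fun_prop
  have := Complex.hasSum_taylorSeries_on_ball (z := 1) hd (by simp)
  simp only [one_smul, sub_zero, one_pow] at this
  refine this.congr_fun fun k => ?_
  rw [iteratedDeriv_line hU hf x y k 0 (by simpa using hx)]
  simp [p]

/-- A complex differentiable map that is smooth in the real sense is analytic. -/
theorem contDiffOn_omega_of_real [FiniteDimensional ℂ E] [CompleteSpace F] {U : Set E}
    (hU : IsOpen U) {f : E → F} (hr : ContDiffOn ℝ ∞ f U) (hc : DifferentiableOn ℂ f U) :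
    ContDiffOn ℂ ω f U :=
  AnalyticOnNhd.contDiffOn_of_completeSpace fun _ hx =>
    analyticAt_of_contDiffOn_complex hU (fun k => contDiffOn_complex_of_real hU k hr hc) hx

end ComplexAnalysis

end SpecialKahler

namespace SpecialKahler

variable {n : ℕ} {M : Type*} [TopologicalSpace M] [ChartedSpace (Fin n → ℂ) M]

/-! ### Composition with linear maps; real and imaginary parts of the complex field. -/

section Derivatives

variable {G H : Type*} [NormedAddCommGroup G] [NormedSpace ℝ G]
  [NormedAddCommGroup H] [NormedSpace ℝ H]

theorem mdifferentiableAt_clm_comp (L : G →L[ℝ] H) {f : M → G} {p : M}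
    (hf : MDifferentiableAt 𝓘(ℝ, Fin n → ℂ) 𝓘(ℝ, G) f p) :
    MDifferentiableAt 𝓘(ℝ, Fin n → ℂ) 𝓘(ℝ, H) (fun q => L (f q)) p :=
  (L.differentiableAt.mdifferentiableAt (x := f p)).comp p hf

theorem mvfderiv_clm_comp (L : G →L[ℝ] H) {f : M → G} {p : M}
    (hf : MDifferentiableAt 𝓘(ℝ, Fin n → ℂ) 𝓘(ℝ, G) f p) (v : RTangent n p) :
    mvfderiv 𝓘(ℝ, Fin n → ℂ) (fun q => L (f q)) p v = L (mvfderiv 𝓘(ℝ, Fin n → ℂ) f p v) := by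
  have h := mfderiv_comp p (L.differentiableAt.mdifferentiableAt (x := f p)) hf
  have h' : mfderiv 𝓘(ℝ, G) 𝓘(ℝ, H) L (f p) = L := by rw [mfderiv_eq_fderiv]; exact L.fderiv
  rw [h'] at h
  exact congrArg (fun T => T v) h

end Derivatives

theorem rePart_symplecticSection (e : OpenPartialHomeomorph M ((Fin n → ℝ) × (Fin n → ℝ)))
    (η lam : Fin n → M → ℂ) (p : M) :
    rePart p (symplecticSection e η lam p)
      = ∑ i, ((η i p).re / 2) • dx e i p + ∑ i, (-(lam i p).re / 2) • dy e i p := by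
  simp only [symplecticSection, rePart, Finset.smul_sum, map_sum, smul_sub, TensorProduct.smul_tmul',
    ← Finset.sum_add_distrib, map_sub]
  refine Finset.sum_congr rfl fun i _ => ?_
  simp [LinearMap.rTensor_tmul, Complex.normSq]
  module

theorem imPart_symplecticSection (e : OpenPartialHomeomorph M ((Fin n → ℝ) × (Fin n → ℝ)))
    (η lam : Fin n → M → ℂ) (p : M) :
    imPart p (symplecticSection e η lam p)
      = ∑ i, ((η i p).im / 2) • dx e i p + ∑ i, (-(lam i p).im / 2) • dy e i p := by
  simp only [symplecticSection, imPart, Finset.smul_sum, map_sum, smul_sub, TensorProduct.smul_tmul',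
    ← Finset.sum_add_distrib, map_sub]
  refine Finset.sum_congr rfl fun i _ => ?_
  simp [LinearMap.rTensor_tmul, Complex.normSq]
  module

theorem piHol_eq (p : M) (v : RTangent n p) :
    piHol p v = (1 : ℂ) ⊗ₜ[ℝ] ((1 / 2 : ℝ) • v) + Complex.I ⊗ₜ[ℝ] (-(1 / 2 : ℝ) • J p v) := by
  have h : ∀ z : ℂ, (1 / 2 : ℂ) • z = (1 / 2 : ℝ) • z := fun z => by
    rw [Complex.real_smul, smul_eq_mul]; norm_num
  rw [piHol, smul_sub, TensorProduct.smul_tmul', TensorProduct.smul_tmul', h, h,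
    TensorProduct.smul_tmul, TensorProduct.smul_tmul, neg_smul, TensorProduct.tmul_neg,
    sub_eq_add_neg]

theorem one_tmul_add_I_tmul_inj {p : M} {a b c d : RTangent n p} :
    (1 : ℂ) ⊗ₜ[ℝ] a + Complex.I ⊗ₜ[ℝ] b = (1 : ℂ) ⊗ₜ[ℝ] c + Complex.I ⊗ₜ[ℝ] d
      ↔ a = c ∧ b = d := by
  constructor
  · intro h
    have h1 := congrArg (rePart p) h
    have h2 := congrArg (imPart p) h
    simp only [rePart, imPart, LinearMap.comp_apply, map_add, LinearMap.rTensor_tmul] at h1 h2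
    simpa using And.intro h1 h2
  · rintro ⟨rfl, rfl⟩; rfl

/-- The components of the real part of the complex vector field with components `η, -lam`. -/
def reComp (η lam : Fin n → M → ℂ) (q : M) : (Fin n → ℝ) × (Fin n → ℝ) :=
  (fun i => (η i q).re, fun i => -(lam i q).re)

/-- The components of the imaginary part of the complex vector field with components `η, -lam`. -/
def imComp (η lam : Fin n → M → ℂ) (q : M) : (Fin n → ℝ) × (Fin n → ℝ) :=
  (fun i => (η i q).im, fun i => -(lam i q).im)

theorem contMDiffAt_reComp {p : M} {η lam : Fin n → M → ℂ}
    (hη : ∀ i, ContMDiffAt 𝓘(ℝ, Fin n → ℂ) 𝓘(ℝ, ℂ) ∞ (η i) p)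
    (hlam : ∀ i, ContMDiffAt 𝓘(ℝ, Fin n → ℂ) 𝓘(ℝ, ℂ) ∞ (lam i) p) :
    ContMDiffAt 𝓘(ℝ, Fin n → ℂ) 𝓘(ℝ, (Fin n → ℝ) × (Fin n → ℝ)) ∞ (reComp η lam) p :=
  (contMDiffAt_pi_space.2 fun i =>
    Complex.reCLM.contMDiff.contMDiffAt.comp p (hη i)).prodMk_space
  (contMDiffAt_pi_space.2 fun i =>
    (-Complex.reCLM).contMDiff.contMDiffAt.comp p (hlam i))

theorem contMDiffAt_imComp {p : M} {η lam : Fin n → M → ℂ}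
    (hη : ∀ i, ContMDiffAt 𝓘(ℝ, Fin n → ℂ) 𝓘(ℝ, ℂ) ∞ (η i) p)
    (hlam : ∀ i, ContMDiffAt 𝓘(ℝ, Fin n → ℂ) 𝓘(ℝ, ℂ) ∞ (lam i) p) :
    ContMDiffAt 𝓘(ℝ, Fin n → ℂ) 𝓘(ℝ, (Fin n → ℝ) × (Fin n → ℝ)) ∞ (imComp η lam) p :=
  (contMDiffAt_pi_space.2 fun i =>
    Complex.imCLM.contMDiff.contMDiffAt.comp p (hη i)).prodMk_space
  (contMDiffAt_pi_space.2 fun i =>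
    (-Complex.imCLM).contMDiff.contMDiffAt.comp p (hlam i))

/-! ### The connection in the flat Darboux frame. -/

section Frame

variable [IsManifold 𝓘(ℂ, Fin n → ℂ) ω M] {K : KahlerMetric n M} {S : SpecialStructure K}

/-- Leibniz rule with the second term killed by parallelism. Differentiability of the sum is carried
along because additivity of the connection requires it. -/
theorem conn_sum_smul_of_parallel (cov : Connection n M) {ι : Type*} (s : Finset ι)
    {f : ι → M → ℝ} {X : ι → VField n M} {p : M}
    (hf : ∀ i, MDifferentiableAt 𝓘(ℝ, Fin n → ℂ) 𝓘(ℝ, ℝ) (f i) p)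
    (hX : ∀ i, DiffAt (X i) p) (h0 : ∀ i, cov (X i) p = 0) (v : RTangent n p) :
    DiffAt (fun q => ∑ i ∈ s, f i q • X i q) p ∧
    cov (fun q => ∑ i ∈ s, f i q • X i q) p v = ∑ i ∈ s, dR (f i) p v • X i p := by
  classical
  have hd : ∀ s : Finset ι, DiffAt (fun q => ∑ i ∈ s, f i q • X i q) p := fun s =>
    MDifferentiableAt.sum_section fun i _ => (hf i).smul_section (hX i)
  refine ⟨hd s, ?_⟩
  induction s using Finset.induction_on with
  | empty =>
    have := CovariantDerivative.zero cov
    simp only [Finset.sum_empty]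
    exact congrArg (fun T => T p v) this
  | insert i s hi ih =>
    have h1 := cov.isCovariantDerivativeOnUniv.add (x := p)
      (MDifferentiableAt.smul_section (hf i) (hX i)) (hd s) trivial
    have h2 := cov.isCovariantDerivativeOnUniv.leibniz (x := p) (hX i) (hf i) trivial
    have h3 : (fun q => ∑ i ∈ insert i s, f i q • X i q)
        = f i • X i + fun q => ∑ i ∈ s, f i q • X i q := by
      funext q; simp [Finset.sum_insert hi]
    rw [h3, Finset.sum_insert hi, ← ih]
    have h4 := congrArg (fun T => T v) h1
    have h5 := congrArg (fun T => T v) h2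
    have h0' : cov.toFun (X i) p = 0 := h0 i
    rw [h0'] at h5
    refine h4.trans ?_
    have : (cov.toFun (f i • X i) p) v = dR (f i) p v • X i p := by
      simpa using h5
    exact congrArg (· + _) this

theorem FlatDarboux.mdifferentiable (D : FlatDarboux S) :
    D.chart.MDifferentiable 𝓘(ℝ, Fin n → ℂ) 𝓘(ℝ, (Fin n → ℝ) × (Fin n → ℝ)) :=
  ⟨D.smooth.mdifferentiableOn (by simp), D.smooth_symm.mdifferentiableOn (by simp)⟩

/-- The differential of a flat Darboux coordinate system. -/
def FlatDarboux.coordDeriv (D : FlatDarboux S) (p : M) :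
    RTangent n p →L[ℝ] (Fin n → ℝ) × (Fin n → ℝ) :=
  mvfderiv 𝓘(ℝ, Fin n → ℂ) D.chart p

/-- The vector field with constant components `w`. -/
def FlatDarboux.coordField (D : FlatDarboux S) (w : (Fin n → ℝ) × (Fin n → ℝ)) : VField n M :=
  VectorField.mpullback 𝓘(ℝ, Fin n → ℂ) 𝓘(ℝ, (Fin n → ℝ) × (Fin n → ℝ)) D.chart (fun _ => w)

/-- The vector field with components `a`. -/
def FlatDarboux.frameField (D : FlatDarboux S) (a : M → (Fin n → ℝ) × (Fin n → ℝ)) : VField n M :=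
  fun q => ∑ i, (a q).1 i • dx D.chart i q + ∑ i, (a q).2 i • dy D.chart i q

variable (D : FlatDarboux S) {p : M}

theorem FlatDarboux.isInvertible (hp : p ∈ D.chart.source) :
    (mfderiv 𝓘(ℝ, Fin n → ℂ) 𝓘(ℝ, (Fin n → ℝ) × (Fin n → ℝ)) D.chart p).IsInvertible :=
  ⟨D.mdifferentiable.mfderiv hp, rfl⟩

theorem FlatDarboux.coordDeriv_injective (hp : p ∈ D.chart.source) :
    Function.Injective (D.coordDeriv p) :=
  (D.mdifferentiable.mfderiv hp).injective

theorem FlatDarboux.coordDeriv_coordField (hp : p ∈ D.chart.source)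
    (w : (Fin n → ℝ) × (Fin n → ℝ)) : D.coordDeriv p (D.coordField w p) = w :=
  (D.isInvertible hp).self_apply_inverse _

theorem FlatDarboux.coordDeriv_dx (hp : p ∈ D.chart.source) (i : Fin n) :
    D.coordDeriv p (dx D.chart i p) = (Pi.single i 1, 0) :=
  D.coordDeriv_coordField hp _

theorem FlatDarboux.coordDeriv_dy (hp : p ∈ D.chart.source) (i : Fin n) :
    D.coordDeriv p (dy D.chart i p) = (0, Pi.single i 1) :=
  D.coordDeriv_coordField hp _

theorem FlatDarboux.diffAt_coordField (hp : p ∈ D.chart.source)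
    (w : (Fin n → ℝ) × (Fin n → ℝ)) : DiffAt (D.coordField w) p := by
  refine MDifferentiableAt.mpullback_vectorField (n := ∞) ?_
    (D.smooth.contMDiffAt (D.chart.open_source.mem_nhds hp)) (D.isInvertible hp) (by norm_cast)
  exact (contMDiffAt_vectorSpace_iff_contDiffAt (n := 1)
    (V := fun _ : (Fin n → ℝ) × (Fin n → ℝ) => w)).2 contDiffAt_const |>.mdifferentiableAt one_ne_zero

theorem FlatDarboux.coordDeriv_frameField (hp : p ∈ D.chart.source)
    (a : M → (Fin n → ℝ) × (Fin n → ℝ)) : D.coordDeriv p (D.frameField a p) = a p := by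
  simp only [FlatDarboux.frameField, map_add, map_sum, map_smul, D.coordDeriv_dx hp,
    D.coordDeriv_dy hp]
  ext i
  · simp [Prod.fst_sum, Finset.sum_apply, Pi.single_apply]
  · simp [Prod.snd_sum, Finset.sum_apply, Pi.single_apply]

/-- The frame is parallel, so only the components get differentiated. -/
theorem FlatDarboux.conn_frameField (hp : p ∈ D.chart.source)
    {a : M → (Fin n → ℝ) × (Fin n → ℝ)}
    (ha : MDifferentiableAt 𝓘(ℝ, Fin n → ℂ) 𝓘(ℝ, (Fin n → ℝ) × (Fin n → ℝ)) a p)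
    (v : RTangent n p) :
    DiffAt (D.frameField a) p ∧
    D.coordDeriv p (S.conn (D.frameField a) p v) = mvfderiv 𝓘(ℝ, Fin n → ℂ) a p v := by
  let L1 : Fin n → ((Fin n → ℝ) × (Fin n → ℝ)) →L[ℝ] ℝ := fun i =>
    (ContinuousLinearMap.proj i).comp (ContinuousLinearMap.fst ℝ _ _)
  let L2 : Fin n → ((Fin n → ℝ) × (Fin n → ℝ)) →L[ℝ] ℝ := fun i =>
    (ContinuousLinearMap.proj i).comp (ContinuousLinearMap.snd ℝ _ _)
  have h1 := conn_sum_smul_of_parallel S.conn Finset.univ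
    (f := fun i q => L1 i (a q)) (fun i => mdifferentiableAt_clm_comp (L1 i) ha)
    (fun i => D.diffAt_coordField hp _) (D.parallel_x p hp) v
  have h2 := conn_sum_smul_of_parallel S.conn Finset.univ
    (f := fun i q => L2 i (a q)) (fun i => mdifferentiableAt_clm_comp (L2 i) ha)
    (fun i => D.diffAt_coordField hp _) (D.parallel_y p hp) v
  have h3 := S.conn.isCovariantDerivativeOnUniv.add (x := p) h1.1 h2.1 trivial
  refine ⟨mdifferentiableAt_add_section h1.1 h2.1, ?_⟩
  have h4 : S.conn (D.frameField a) p v = _ := congrArg (fun T => T v) h3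
  rw [h4]
  refine (map_add _ _ _).trans ?_
  refine (congrArg₂ (fun x y => D.coordDeriv p x + D.coordDeriv p y) h1.2 h2.2).trans ?_
  simp only [map_sum, map_smul, D.coordDeriv_coordField hp, dR]
  simp only [mvfderiv_clm_comp _ ha]
  ext i
  · simp [Prod.fst_sum, Finset.sum_apply, Pi.single_apply, L1]
  · simp [Prod.snd_sum, Finset.sum_apply, Pi.single_apply, L2]

/-- The factors `1/2` in `χ` and in `π^(1,0)` cancel. What remains is a first-order system for the
components, used in one direction for the properties of `η, lam` and in the other for their
existence. -/
theorem nablaC_symplecticSection_eq_piHol_iff (hp : p ∈ D.chart.source) {η lam : Fin n → M → ℂ}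
    (hre : MDifferentiableAt 𝓘(ℝ, Fin n → ℂ) 𝓘(ℝ, (Fin n → ℝ) × (Fin n → ℝ)) (reComp η lam) p)
    (him : MDifferentiableAt 𝓘(ℝ, Fin n → ℂ) 𝓘(ℝ, (Fin n → ℝ) × (Fin n → ℝ)) (imComp η lam) p)
    (v : RTangent n p) :
    nablaC S.conn (symplecticSection D.chart η lam) p v = piHol p v ↔
      mvfderiv 𝓘(ℝ, Fin n → ℂ) (reComp η lam) p v = D.coordDeriv p v ∧
      mvfderiv 𝓘(ℝ, Fin n → ℂ) (imComp η lam) p v = -D.coordDeriv p (J p v) := by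
  let L := (1 / 2 : ℝ) • ContinuousLinearMap.id ℝ ((Fin n → ℝ) × (Fin n → ℝ))
  have h1 : (fun q => rePart q (symplecticSection D.chart η lam q))
      = D.frameField (fun q => L (reComp η lam q)) := by
    funext q
    rw [rePart_symplecticSection]
    simp [FlatDarboux.frameField, L, reComp, div_eq_inv_mul]
  have h2 : (fun q => imPart q (symplecticSection D.chart η lam q))
      = D.frameField (fun q => L (imComp η lam q)) := by
    funext q
    rw [imPart_symplecticSection]
    simp [FlatDarboux.frameField, L, imComp, div_eq_inv_mul]
  have hinj := D.coordDeriv_injective hp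
  have half : (1 / 2 : ℝ) ≠ 0 := by norm_num
  rw [nablaC, h1, h2, piHol_eq, one_tmul_add_I_tmul_inj, ← hinj.eq_iff,
    (D.conn_frameField hp (mdifferentiableAt_clm_comp L hre) v).2, mvfderiv_clm_comp L hre,
    ← hinj.eq_iff (b := -(1 / 2 : ℝ) • J p v),
    (D.conn_frameField hp (mdifferentiableAt_clm_comp L him) v).2, mvfderiv_clm_comp L him]
  refine and_congr ?_ ?_
  · rw [map_smul]
    exact smul_right_injective _ half |>.eq_iff
  · rw [map_smul, neg_smul, ← smul_neg]
    exact smul_right_injective _ half |>.eq_iff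

/-- The differentials of the components of a vector field `χ` with `∇χ = π^(1,0)`. -/
theorem IsSpecialPair.mvfderiv_eq {V : Set M} {η lam : Fin n → M → ℂ} {D : FlatDarboux S}
    (h : IsSpecialPair D V η lam) (hV : IsOpen V) (hVD : V ⊆ D.chart.source) (hp : p ∈ V)
    (v : RTangent n p) (i : Fin n) :
    mvfderiv 𝓘(ℝ, Fin n → ℂ) (η i) p v
        = (D.coordDeriv p v).1 i - Complex.I * (D.coordDeriv p (J p v)).1 i ∧
    mvfderiv 𝓘(ℝ, Fin n → ℂ) (lam i) p v
        = -((D.coordDeriv p v).2 i - Complex.I * (D.coordDeriv p (J p v)).2 i) := by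
  have hη' := fun i => (h.smooth_eta i).contMDiffAt (hV.mem_nhds hp)
  have hlam' := fun i => (h.smooth_lam i).contMDiffAt (hV.mem_nhds hp)
  have hη := fun i => (hη' i).mdifferentiableAt (by simp)
  have hlam := fun i => (hlam' i).mdifferentiableAt (by simp)
  have hre := (contMDiffAt_reComp hη' hlam').mdifferentiableAt (by simp)
  have him := (contMDiffAt_imComp hη' hlam').mdifferentiableAt (by simp)
  obtain ⟨h1, h2⟩ := (nablaC_symplecticSection_eq_piHol_iff D (hVD hp) hre him v).1
    (h.nabla_eq p hp v)
  let L1 : ((Fin n → ℝ) × (Fin n → ℝ)) →L[ℝ] ℝ :=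
    (ContinuousLinearMap.proj i).comp (ContinuousLinearMap.fst ℝ _ _)
  let L2 : ((Fin n → ℝ) × (Fin n → ℝ)) →L[ℝ] ℝ :=
    (ContinuousLinearMap.proj i).comp (ContinuousLinearMap.snd ℝ _ _)
  have a1 := (mvfderiv_clm_comp Complex.reCLM (hη i) v).symm.trans (mvfderiv_clm_comp L1 hre v)
  have a2 := (mvfderiv_clm_comp (-Complex.reCLM) (hlam i) v).symm.trans (mvfderiv_clm_comp L2 hre v)
  have a3 := (mvfderiv_clm_comp Complex.imCLM (hη i) v).symm.trans (mvfderiv_clm_comp L1 him v)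
  have a4 := (mvfderiv_clm_comp (-Complex.imCLM) (hlam i) v).symm.trans (mvfderiv_clm_comp L2 him v)
  rw [h1] at a1 a2
  rw [h2] at a3 a4
  simp only [L1, L2, neg_apply, Complex.reCLM_apply, Complex.imCLM_apply,
    ContinuousLinearMap.comp_apply, ContinuousLinearMap.proj_apply, ContinuousLinearMap.coe_fst',
    ContinuousLinearMap.coe_snd', Prod.fst_neg, Prod.snd_neg, Pi.neg_apply] at a1 a2 a3 a4
  constructor
  · apply Complex.ext
    · simp [a1]
    · simp [a3]
  · apply Complex.ext
    · simp; linarith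
    · simp; linarith

end Frame

end SpecialKahler

namespace SpecialKahler

variable {n : ℕ} {M : Type*} [TopologicalSpace M] [ChartedSpace (Fin n → ℂ) M]

theorem J_J (p : M) (v : RTangent n p) : J p (J p v) = -v := by
  have : ∀ v : Fin n → ℂ, Complex.I • Complex.I • v = -v := fun v => by
    rw [smul_smul, Complex.I_mul_I, neg_one_smul]
  exact this v

/-! ### The Kähler form in flat coordinates: nondegeneracy and type. -/

section Kahler

variable [IsManifold 𝓘(ℂ, Fin n → ℂ) ω M] (K : KahlerMetric n M)

/-- The fundamental form as a bilinear map. -/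
def KahlerMetric.formBilin (p : M) : RTangent n p →ₗ[ℝ] RTangent n p →ₗ[ℝ] ℝ :=
  LinearMap.mk₂ ℝ (K.form p)
    (fun u v w => by simp only [KahlerMetric.form, map_add]; rfl)
    (fun c u v => by simp only [KahlerMetric.form, map_smul]; rfl)
    (fun u v w => by simp only [KahlerMetric.form, map_add])
    (fun c u v => by simp only [KahlerMetric.form, map_smul])

theorem KahlerMetric.form_J_J (p : M) (u v : RTangent n p) :
    K.form p (J p u) (J p v) = K.form p u v :=
  K.hermitian p u (J p v)

theorem KahlerMetric.form_antisymm (p : M) (u v : RTangent n p) :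
    K.form p u v = -K.form p v u := by
  have h1 : K.g.inner p u (J p v) = K.g.inner p (J p u) (J p (J p v)) := (K.hermitian p _ _).symm
  have h2 : K.g.inner p (J p u) (-v) = -K.g.inner p (J p u) v := map_neg _ _
  rw [KahlerMetric.form, h1, J_J, h2, K.g.symm]
  rfl

theorem KahlerMetric.form_self_J (p : M) (v : RTangent n p) :
    K.form p v (J p v) = -K.g.inner p v v := by
  rw [KahlerMetric.form, J_J]
  exact map_neg _ _

theorem KahlerMetric.eq_zero_of_form_self_J (p : M) (v : RTangent n p)
    (h : K.form p v (J p v) = 0) : v = 0 := by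
  by_contra hv
  have := K.g.pos p v hv
  rw [K.form_self_J] at h
  linarith

variable {K} {S : SpecialStructure K} (D : FlatDarboux S) {p : M}

theorem FlatDarboux.form_eq (hp : p ∈ D.chart.source) (u v : RTangent n p) :
    K.form p u v = ∑ i, ((D.coordDeriv p u).1 i * (D.coordDeriv p v).2 i
      - (D.coordDeriv p v).1 i * (D.coordDeriv p u).2 i) := by
  have hexp : ∀ u : RTangent n p, u = ∑ i, (D.coordDeriv p u).1 i • dx D.chart i p
      + ∑ i, (D.coordDeriv p u).2 i • dy D.chart i p := fun u => by
    apply D.coordDeriv_injective hp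
    have := D.coordDeriv_frameField hp (fun _ => D.coordDeriv p u)
    exact this.symm
  have hyx : ∀ i j, K.form p (dy D.chart i p) (dx D.chart j p) = if i = j then -1 else 0 := by
    intro i j
    rw [K.form_antisymm, D.form_xy p hp]
    simp only [eq_comm (a := j)]
    split_ifs <;> simp
  have hB : ∀ u v, K.form p u v = K.formBilin p u v := fun _ _ => rfl
  have hxx := D.form_xx p hp
  have hxy := D.form_xy p hp
  have hyy := D.form_yy p hp
  simp only [hB] at hxx hxy hyy hyx ⊢
  conv_lhs => rw [hexp u, hexp v]
  simp only [map_add, map_sum, map_smul, LinearMap.add_apply, LinearMap.sum_apply,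
    LinearMap.smul_apply, hxx, hxy, hyy, hyx]
  simp [Finset.sum_sub_distrib]
  rw [neg_add_eq_sub]
  simp only [mul_comm]

/-- The subspace `dx = 0` is Lagrangian; a Lagrangian subspace containing `v` and `Jv` forces
`g(v,v) = -Φ(v,Jv) = 0`. -/
theorem FlatDarboux.eq_zero_of_fst (hp : p ∈ D.chart.source) (v : RTangent n p)
    (h : (D.coordDeriv p v).1 = 0) (hJ : (D.coordDeriv p (J p v)).1 = 0) : v = 0 := by
  apply K.eq_zero_of_form_self_J p v
  rw [D.form_eq hp, h, hJ]
  simp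

theorem FlatDarboux.eq_zero_of_snd (hp : p ∈ D.chart.source) (v : RTangent n p)
    (h : (D.coordDeriv p v).2 = 0) (hJ : (D.coordDeriv p (J p v)).2 = 0) : v = 0 := by
  apply K.eq_zero_of_form_self_J p v
  rw [D.form_eq hp, h, hJ]
  simp

/-- Both differentials factor through `1 - iJ`, on which composition with `J` is multiplication by
`i`. -/
theorem IsSpecialPair.mvfderiv_J {V : Set M} {η lam : Fin n → M → ℂ} {D : FlatDarboux S}
    (h : IsSpecialPair D V η lam) (hV : IsOpen V) (hVD : V ⊆ D.chart.source) (hp : p ∈ V)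
    (v : RTangent n p) (i : Fin n) :
    mvfderiv 𝓘(ℝ, Fin n → ℂ) (η i) p (J p v)
        = Complex.I * mvfderiv 𝓘(ℝ, Fin n → ℂ) (η i) p v ∧
    mvfderiv 𝓘(ℝ, Fin n → ℂ) (lam i) p (J p v)
        = Complex.I * mvfderiv 𝓘(ℝ, Fin n → ℂ) (lam i) p v := by
  obtain ⟨h1, h2⟩ := h.mvfderiv_eq hV hVD hp v i
  obtain ⟨h3, h4⟩ := h.mvfderiv_eq hV hVD hp (J p v) i
  rw [h1, h2, h3, h4, J_J]
  have hI := Complex.I_mul_I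
  have hneg : D.coordDeriv p (-v) = -D.coordDeriv p v := map_neg _ _
  rw [hneg]
  simp only [Prod.fst_neg, Prod.snd_neg, Pi.neg_apply, Complex.ofReal_neg]
  constructor
  · linear_combination ((D.coordDeriv p (J p v)).1 i : ℂ) * hI
  · linear_combination (-((D.coordDeriv p (J p v)).2 i : ℂ)) * hI

/-- The real and imaginary parts of `dη^j(v)` are `dx^j(v)` and `-dx^j(Jv)`. -/
theorem IsSpecialPair.eq_zero_of_mvfderiv_eta {V : Set M} {η lam : Fin n → M → ℂ}
    {D : FlatDarboux S} (h : IsSpecialPair D V η lam) (hV : IsOpen V) (hVD : V ⊆ D.chart.source)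
    (hp : p ∈ V) (v : RTangent n p) (hv : ∀ i, mvfderiv 𝓘(ℝ, Fin n → ℂ) (η i) p v = 0) :
    v = 0 := by
  have h1 := fun i => ((h.mvfderiv_eq hV hVD hp v i).1.symm.trans (hv i))
  refine D.eq_zero_of_fst (hVD hp) v (funext fun i => ?_) (funext fun i => ?_)
  · simpa using congrArg Complex.re (h1 i)
  · simpa using congrArg Complex.im (h1 i)

theorem IsSpecialPair.eq_zero_of_mvfderiv_lam {V : Set M} {η lam : Fin n → M → ℂ}
    {D : FlatDarboux S} (h : IsSpecialPair D V η lam) (hV : IsOpen V) (hVD : V ⊆ D.chart.source)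
    (hp : p ∈ V) (v : RTangent n p) (hv : ∀ i, mvfderiv 𝓘(ℝ, Fin n → ℂ) (lam i) p v = 0) :
    v = 0 := by
  have h1 := fun i => ((h.mvfderiv_eq hV hVD hp v i).2.symm.trans (hv i))
  refine D.eq_zero_of_snd (hVD hp) v (funext fun i => ?_) (funext fun i => ?_)
  · simpa using congrArg Complex.re (h1 i)
  · simpa using congrArg Complex.im (h1 i)

/-- The holomorphic 2-form `∑ dλ_j ∧ dη^j` vanishes. -/
theorem IsSpecialPair.sum_wedge_eq_zero {V : Set M} {η lam : Fin n → M → ℂ}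
    {D : FlatDarboux S} (h : IsSpecialPair D V η lam) (hV : IsOpen V) (hVD : V ⊆ D.chart.source)
    (hp : p ∈ V) (u v : RTangent n p) :
    ∑ j, mvfderiv 𝓘(ℝ, Fin n → ℂ) (lam j) p u * mvfderiv 𝓘(ℝ, Fin n → ℂ) (η j) p v
      = ∑ j, mvfderiv 𝓘(ℝ, Fin n → ℂ) (lam j) p v * mvfderiv 𝓘(ℝ, Fin n → ℂ) (η j) p u := by
  -- The real part of the difference of the two sides is `Φ(u,v) - Φ(Ju,Jv)` and the imaginary part
  -- is `-(Φ(u,Jv) + Φ(Ju,v))`; `e1` and `e2` make them vanish.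
  have e1 := K.form_J_J p u v
  have e2 := K.form_J_J p u (J p v)
  rw [J_J, show K.form p (J p u) (-v) = -K.form p (J p u) v from (K.formBilin p _).map_neg _] at e2
  simp only [D.form_eq (hVD hp)] at e1 e2
  rw [← sub_eq_zero, ← Finset.sum_sub_distrib] at e1 ⊢
  rw [← sub_eq_zero, ← Finset.sum_neg_distrib, ← Finset.sum_sub_distrib] at e2
  simp only [fun w j => (h.mvfderiv_eq hV hVD hp w j).1, fun w j => (h.mvfderiv_eq hV hVD hp w j).2]
  apply Complex.ext
  · rw [Complex.re_sum, Complex.zero_re, ← neg_eq_zero, ← e1, ← Finset.sum_neg_distrib]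
    refine Finset.sum_congr rfl fun j _ => ?_
    simp; ring
  · rw [Complex.im_sum, Complex.zero_im, ← e2]
    refine Finset.sum_congr rfl fun j _ => ?_
    simp; ring

end Kahler

end SpecialKahler

namespace SpecialKahler

variable {n : ℕ} {M : Type*} [TopologicalSpace M] [ChartedSpace (Fin n → ℂ) M]

/-! ### Comparison of real and complex derivatives on the manifold. -/

section ComplexReal

variable {G : Type*} [NormedAddCommGroup G] [NormedSpace ℂ G]

theorem mdifferentiableAt_real_of_complex {f : M → G} {p : M}
    (h : MDifferentiableAt 𝓘(ℂ, Fin n → ℂ) 𝓘(ℂ, G) f p) :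
    MDifferentiableAt 𝓘(ℝ, Fin n → ℂ) 𝓘(ℝ, G) f p := by
  rw [mdifferentiableAt_iff] at h ⊢
  exact ⟨h.1, h.2.restrictScalars ℝ⟩

theorem mvfderiv_real_eq_complex {f : M → G} {p : M}
    (h : MDifferentiableAt 𝓘(ℂ, Fin n → ℂ) 𝓘(ℂ, G) f p) (v : RTangent n p) :
    mvfderiv 𝓘(ℝ, Fin n → ℂ) f p v = mvfderiv 𝓘(ℂ, Fin n → ℂ) f p v := by
  have h1 := (mdifferentiableAt_real_of_complex h).mvfderiv
  have h2 := h.mvfderiv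
  have h3 := ((mdifferentiableAt_iff _ _).1 h).2
  simp only [modelWithCornersSelf_coe, Set.range_id, fderivWithin_univ,
    differentiableWithinAt_univ] at h1 h2 h3
  have h4 := h3.fderiv_restrictScalars ℝ
  exact (congrArg (fun T => T v) h1).trans ((congrArg (fun T => T v) h4).trans
    (congrArg (fun T => T v) h2).symm)

theorem mvfderiv_J_of_complex {f : M → G} {p : M}
    (h : MDifferentiableAt 𝓘(ℂ, Fin n → ℂ) 𝓘(ℂ, G) f p) (v : RTangent n p) :
    mvfderiv 𝓘(ℝ, Fin n → ℂ) f p (J p v) = Complex.I • mvfderiv 𝓘(ℝ, Fin n → ℂ) f p v := by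
  rw [mvfderiv_real_eq_complex h, mvfderiv_real_eq_complex h]
  exact (mvfderiv 𝓘(ℂ, Fin n → ℂ) f p).map_smul Complex.I v

theorem mdifferentiableAt_complex_of_mvfderiv_J {f : M → G} {p : M}
    (h : MDifferentiableAt 𝓘(ℝ, Fin n → ℂ) 𝓘(ℝ, G) f p)
    (hJ : ∀ v, mvfderiv 𝓘(ℝ, Fin n → ℂ) f p (J p v) = Complex.I • mvfderiv 𝓘(ℝ, Fin n → ℂ) f p v) :
    MDifferentiableAt 𝓘(ℂ, Fin n → ℂ) 𝓘(ℂ, G) f p := by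
  have h1 := h.mvfderiv
  have h3 := ((mdifferentiableAt_iff _ _).1 h)
  rw [mdifferentiableAt_iff]
  refine ⟨h3.1, ?_⟩
  have h4 := h3.2
  simp only [modelWithCornersSelf_coe, Set.range_id, fderivWithin_univ,
    differentiableWithinAt_univ] at h1 h4 ⊢
  refine differentiableAt_complex_of_fderiv_I_smul h4 fun v => ?_
  exact (congrArg (fun T => T (J p v)) h1).symm.trans ((hJ v).trans
    (congrArg (fun T => Complex.I • T v) h1))

end ComplexReal

/-! ### Local existence of the special pair. -/

section Existence

variable [IsManifold 𝓘(ℂ, Fin n → ℂ) ω M] {K : KahlerMetric n M} {S : SpecialStructure K}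
  (D : FlatDarboux S)

theorem FlatDarboux.conn_coordField {p : M} (hp : p ∈ D.chart.source)
    (w : (Fin n → ℝ) × (Fin n → ℝ)) : S.conn (D.coordField w) p = 0 := by
  have h := fun v => D.conn_frameField hp (a := fun _ => w) mdifferentiableAt_const v
  have hev : ∀ᶠ q in nhds p, D.coordField w q = D.frameField (fun _ => w) q := by
    filter_upwards [D.chart.open_source.mem_nhds hp] with q hq
    apply D.coordDeriv_injective hq
    rw [D.coordDeriv_coordField hq, D.coordDeriv_frameField hq]
  have h1 : S.conn (D.coordField w) p = S.conn (D.frameField fun _ => w) p :=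
    S.conn.isCovariantDerivativeOnUniv.congr_of_eventuallyEq (D.diffAt_coordField hp w)
      (h 0).1 Filter.univ_mem hev
  rw [h1]
  ext1 v
  apply D.coordDeriv_injective hp
  rw [(h v).2, mvfderiv_const]
  simp

/-- For parallel fields the torsion reduces to minus the bracket. -/
theorem FlatDarboux.bracket_coordField {p : M} (hp : p ∈ D.chart.source)
    (u w : (Fin n → ℝ) × (Fin n → ℝ)) : bracket (D.coordField u) (D.coordField w) p = 0 := by
  have h := S.conn.torsion_apply (D.diffAt_coordField hp u) (D.diffAt_coordField hp w)
  rw [S.torsionFree, D.conn_coordField hp, D.conn_coordField hp] at h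
  simpa using h.symm

/-- The matrix of `J` in the flat coordinates, as a function of the coordinates. -/
def FlatDarboux.complexStructure (w : (Fin n → ℝ) × (Fin n → ℝ)) :
    ((Fin n → ℝ) × (Fin n → ℝ)) →L[ℝ] ((Fin n → ℝ) × (Fin n → ℝ)) :=
  (D.coordDeriv (D.chart.symm w)).comp ((J (D.chart.symm w)).comp
    (mfderiv 𝓘(ℝ, (Fin n → ℝ) × (Fin n → ℝ)) 𝓘(ℝ, Fin n → ℂ) D.chart.symm w))

theorem FlatDarboux.complexStructure_apply {q : M} (hq : q ∈ D.chart.source)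
    (u : (Fin n → ℝ) × (Fin n → ℝ)) :
    D.complexStructure (D.chart q) u = D.coordDeriv q (J q (D.coordField u q)) := by
  have hw : D.chart q ∈ D.chart.target := D.chart.map_source hq
  -- The base point is generalised because `D.chart.symm (D.chart q)` is only propositionally `q`,
  -- and the tangent spaces depend on it.
  have key : ∀ q', q' = q → ∀ B : RTangent n q', D.coordDeriv q' B = u →
      D.coordDeriv q' (J q' B) = D.coordDeriv q (J q (D.coordField u q)) := by
    rintro _ rfl B hB
    rw [D.coordDeriv_injective hq (hB.trans (D.coordDeriv_coordField hq u).symm)]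
  refine key _ (D.chart.left_inv hq) _ ?_
  exact congrArg (fun T => T u) (D.mdifferentiable.comp_symm_deriv hw)

theorem FlatDarboux.complexStructure_coordDeriv {q : M} (hq : q ∈ D.chart.source)
    (v : RTangent n q) : D.complexStructure (D.chart q) (D.coordDeriv q v)
      = D.coordDeriv q (J q v) := by
  rw [D.complexStructure_apply hq]
  congr 2
  exact D.coordDeriv_injective hq (D.coordDeriv_coordField hq _)

/-- The flat coordinates are smooth functions of the holomorphic coordinates around `p` and
conversely, so that the matrix of `J` is smooth. -/
theorem FlatDarboux.contDiffOn_complexStructure :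
    ContDiffOn ℝ ∞ D.complexStructure D.chart.target := by
  intro w₀ hw₀
  let φ := chartAt (Fin n → ℂ) (D.chart.symm w₀)
  let O : Set ((Fin n → ℝ) × (Fin n → ℝ)) := D.chart.target ∩ D.chart.symm ⁻¹' φ.source
  have hO : IsOpen O := D.chart.isOpen_inter_preimage_symm φ.open_source
  have hw₀O : w₀ ∈ O := ⟨hw₀, mem_chart_source _ _⟩
  let O' : Set (Fin n → ℂ) := φ.target ∩ φ.symm ⁻¹' D.chart.source
  have hO' : IsOpen O' := φ.isOpen_inter_preimage_symm D.chart.open_source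
  have hφ : φ ∈ IsManifold.maximalAtlas 𝓘(ℝ, Fin n → ℂ) ω M := IsManifold.chart_mem_maximalAtlas _
  have hφC : φ ∈ IsManifold.maximalAtlas 𝓘(ℂ, Fin n → ℂ) ω M := IsManifold.chart_mem_maximalAtlas _
  have h1 : ContDiffOn ℝ ∞ (fun w => φ (D.chart.symm w)) O := by
    rw [← contMDiffOn_iff_contDiffOn]
    exact ((contMDiffOn_of_mem_maximalAtlas hφ).of_le le_top).comp
      (D.smooth_symm.mono Set.inter_subset_left) fun w hw => hw.2
  have h2 : ContDiffOn ℝ ∞ (fun z => D.chart (φ.symm z)) O' := by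
    rw [← contMDiffOn_iff_contDiffOn]
    exact D.smooth.comp (((contMDiffOn_symm_of_mem_maximalAtlas hφ).of_le le_top).mono
      Set.inter_subset_left) fun w hw => hw.2
  have hmaps : Set.MapsTo (fun w => φ (D.chart.symm w)) O O' := fun w hw =>
    ⟨φ.map_source hw.2, by
      simp only [Set.mem_preimage, φ.left_inv hw.2]; exact D.chart.map_target hw.1⟩
  let I' : (Fin n → ℂ) →L[ℝ] (Fin n → ℂ) := Complex.I • ContinuousLinearMap.id ℝ (Fin n → ℂ)
  -- In a holomorphic chart `J` is the constant `i`, so its matrix in the flat coordinates is `i`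
  -- conjugated by the smooth change of coordinates.
  have h3 : ContDiffOn ℝ ∞ (fun w => (fderiv ℝ (fun z => D.chart (φ.symm z))
      (φ (D.chart.symm w))).comp (I'.comp (fderiv ℝ (fun w => φ (D.chart.symm w)) w))) O :=
    (((contDiffOn_infty_iff_fderiv_of_isOpen hO').1 h2).2.comp h1 hmaps).clm_comp
      (contDiffOn_const.clm_comp ((contDiffOn_infty_iff_fderiv_of_isOpen hO).1 h1).2)
  refine ContDiffAt.contDiffWithinAt ?_
  refine (h3.contDiffAt (hO.mem_nhds hw₀O)).congr_of_eventuallyEq ?_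
  filter_upwards [hO.mem_nhds hw₀O] with w hw
  have hq : D.chart.symm w ∈ D.chart.source := D.chart.map_target hw.1
  refine ContinuousLinearMap.ext fun u => ?_
  let B : RTangent n (D.chart.symm w) :=
    mfderiv 𝓘(ℝ, (Fin n → ℝ) × (Fin n → ℝ)) 𝓘(ℝ, Fin n → ℂ) D.chart.symm w u
  have hφd : MDifferentiableAt 𝓘(ℂ, Fin n → ℂ) 𝓘(ℂ, Fin n → ℂ) φ (D.chart.symm w) :=
    (contMDiffAt_of_mem_maximalAtlas hφC hw.2).mdifferentiableAt (by simp)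
  have hφr := mdifferentiableAt_real_of_complex hφd
  have c1 : fderiv ℝ (fun w => φ (D.chart.symm w)) w u
      = mvfderiv 𝓘(ℝ, Fin n → ℂ) φ (D.chart.symm w) B := by
    rw [← mfderiv_eq_fderiv]
    exact mfderiv_comp_apply w hφr (D.mdifferentiable.mdifferentiableAt_symm hw.1) u
  have c2 : ∀ B : RTangent n (D.chart.symm w), fderiv ℝ (fun z => D.chart (φ.symm z))
      (φ (D.chart.symm w)) (mvfderiv 𝓘(ℝ, Fin n → ℂ) φ (D.chart.symm w) B)
      = D.coordDeriv (D.chart.symm w) B := by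
    intro B
    have hev : (fun q => D.chart (φ.symm (φ q))) =ᶠ[nhds (D.chart.symm w)] D.chart := by
      filter_upwards [φ.open_source.mem_nhds hw.2] with q hq
      rw [φ.left_inv hq]
    have hd : MDifferentiableAt 𝓘(ℝ, Fin n → ℂ) 𝓘(ℝ, (Fin n → ℝ) × (Fin n → ℝ))
        (fun z => D.chart (φ.symm z)) (φ (D.chart.symm w)) :=
      ((h2.contDiffAt (hO'.mem_nhds (hmaps hw))).differentiableAt (by simp)).mdifferentiableAt
    have e1 := mfderiv_comp_apply (D.chart.symm w) hd hφr B
    have e2 := hev.mfderiv_eq (I := 𝓘(ℝ, Fin n → ℂ)) (I' := 𝓘(ℝ, (Fin n → ℝ) × (Fin n → ℝ)))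
    rw [mfderiv_eq_fderiv] at e1
    exact e1.symm.trans (congrArg (fun T => T B) e2)
  have c3 := mvfderiv_J_of_complex hφd B
  calc D.complexStructure w u = D.coordDeriv _ (J _ B) := rfl
    _ = _ := (c2 _).symm
    _ = fderiv ℝ (fun z => D.chart (φ.symm z)) (φ (D.chart.symm w))
        (Complex.I • mvfderiv 𝓘(ℝ, Fin n → ℂ) φ (D.chart.symm w) B) := by rw [c3]
    _ = _ := by rw [← c1]; rfl

/-- This is `d_∇ J = 0` on coordinate fields: the bracket term drops out, and the matrix of `J`,
read as a vector-valued 1-form on the flat coordinates, is closed. -/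
theorem FlatDarboux.fderiv_complexStructure_symm {w : (Fin n → ℝ) × (Fin n → ℝ)}
    (hw : w ∈ D.chart.target) (u v : (Fin n → ℝ) × (Fin n → ℝ)) :
    fderiv ℝ D.complexStructure w u v = fderiv ℝ D.complexStructure w v u := by
  obtain ⟨q, hq, rfl⟩ : ∃ q ∈ D.chart.source, D.chart q = w :=
    ⟨_, D.chart.map_target hw, D.chart.right_inv hw⟩
  have hT : DifferentiableAt ℝ D.complexStructure (D.chart q) :=
    (D.contDiffOn_complexStructure.contDiffAt
      (D.chart.open_target.mem_nhds hw)).differentiableAt (by simp)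
  have hTv : ∀ v, HasFDerivAt (fun w => D.complexStructure w v)
      ((fderiv ℝ D.complexStructure (D.chart q)).flip v) (D.chart q) := fun v => by
    simpa using hT.hasFDerivAt.clm_apply (hasFDerivAt_const v (D.chart q))
  -- The field `J ∂_v` has components `T v`, with `T` the matrix of `J`, so `∇_{∂_u}(J ∂_v)` has
  -- components `(∂_u T) v`.
  have key : ∀ u v, DiffAt (fun q => J q (D.coordField v q)) q ∧
      D.coordDeriv q (S.conn (fun q => J q (D.coordField v q)) q (D.coordField u q))
      = fderiv ℝ D.complexStructure (D.chart q) u v := by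
    intro u v
    have he := D.mdifferentiable.mdifferentiableAt hq
    have ha : MDifferentiableAt 𝓘(ℝ, Fin n → ℂ) 𝓘(ℝ, (Fin n → ℝ) × (Fin n → ℝ))
        (fun q => D.complexStructure (D.chart q) v) q :=
      (hTv v).differentiableAt.mdifferentiableAt.comp q he
    have hev : ∀ᶠ q' in nhds q, J q' (D.coordField v q')
        = D.frameField (fun q => D.complexStructure (D.chart q) v) q' := by
      filter_upwards [D.chart.open_source.mem_nhds hq] with q' hq'
      apply D.coordDeriv_injective hq'
      rw [D.coordDeriv_frameField hq', D.complexStructure_apply hq']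
    obtain ⟨h1, h2⟩ := D.conn_frameField hq ha (D.coordField u q)
    have h3 : DiffAt (fun q => J q (D.coordField v q)) q := by
      refine h1.congr_of_eventuallyEq ?_
      filter_upwards [hev] with q' hq'
      rw [hq']
    refine ⟨h3, ?_⟩
    have h4 := S.conn.isCovariantDerivativeOnUniv.congr_of_eventuallyEq h3 h1 Filter.univ_mem hev
    refine (congrArg (fun T => D.coordDeriv q (T (D.coordField u q))) h4).trans (h2.trans ?_)
    have h5 := mfderiv_comp_apply q (hTv v).differentiableAt.mdifferentiableAt he (D.coordField u q)
    rw [mfderiv_eq_fderiv, (hTv v).fderiv] at h5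
    refine Eq.trans h5 ?_
    exact congrArg (fun x => fderiv ℝ D.complexStructure (D.chart q) x v)
      (D.coordDeriv_coordField hq u)
  have hs := S.special (D.coordField u) (D.coordField v) q (D.diffAt_coordField hq u)
    (D.diffAt_coordField hq v)
  rw [covExtDeriv, D.bracket_coordField hq, map_zero, sub_zero, sub_eq_zero] at hs
  rw [← (key u v).2, ← (key v u).2, hs]

theorem FlatDarboux.exists_isSpecialPair {p : M} (hp : p ∈ D.chart.source) :
    ∃ V : Set M, IsOpen V ∧ p ∈ V ∧ V ⊆ D.chart.source ∧
      ∃ η lam : Fin n → M → ℂ, IsSpecialPair D V η lam := by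
  obtain ⟨r, hr, hball⟩ := Metric.isOpen_iff.1 D.chart.open_target _ (D.chart.map_source hp)
  set B := Metric.ball (D.chart p) r
  have hB : IsOpen B := Metric.isOpen_ball
  have hTs := D.contDiffOn_complexStructure.mono hball
  -- Poincaré lemma: the closed form `T` has a primitive `P`, whose pullback to `M` has differential
  -- `d(x, y) ∘ J`.
  obtain ⟨P, hP⟩ := (convex_ball (D.chart p) r).exists_forall_hasFDerivAt_of_fderiv_symmetric
    hB (hTs.differentiableOn (by simp))
    fun a ha => D.fderiv_complexStructure_symm (hball ha)
  have hPs : ContDiffOn ℝ ∞ P B := by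
    refine (contDiffOn_infty_iff_fderiv_of_isOpen hB).2
      ⟨fun a ha => (hP a ha).differentiableAt.differentiableWithinAt, hTs.congr fun a ha => ?_⟩
    exact (hP a ha).fderiv
  let V := D.chart.source ∩ D.chart ⁻¹' B
  have hV : IsOpen V := D.chart.isOpen_inter_preimage hB
  have hes : ContMDiffOn 𝓘(ℝ, Fin n → ℂ) 𝓘(ℝ, (Fin n → ℝ) × (Fin n → ℝ)) ∞ D.chart V :=
    D.smooth.mono Set.inter_subset_left
  have hPe : ContMDiffOn 𝓘(ℝ, Fin n → ℂ) 𝓘(ℝ, (Fin n → ℝ) × (Fin n → ℝ)) ∞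
      (fun q => P (D.chart q)) V := hPs.contMDiffOn.comp hes fun q hq => hq.2
  let L1 : Fin n → ((Fin n → ℝ) × (Fin n → ℝ)) →L[ℝ] ℂ := fun i =>
    Complex.ofRealCLM.comp ((ContinuousLinearMap.proj i).comp (ContinuousLinearMap.fst ℝ _ _))
  let L2 : Fin n → ((Fin n → ℝ) × (Fin n → ℝ)) →L[ℝ] ℂ := fun i =>
    Complex.ofRealCLM.comp ((ContinuousLinearMap.proj i).comp (ContinuousLinearMap.snd ℝ _ _))
  -- Thus `η = x - iP₁` and `lam = -(y - iP₂)`, with `P = (P₁, P₂)`.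
  let η : Fin n → M → ℂ := fun i q => L1 i (D.chart q) - (Complex.I • L1 i) (P (D.chart q))
  let lam : Fin n → M → ℂ := fun i q => -(L2 i (D.chart q) - (Complex.I • L2 i) (P (D.chart q)))
  have hre : reComp η lam = D.chart := by
    funext q
    ext i <;> simp [reComp, η, lam, L1, L2]
  have him : imComp η lam = fun q => -P (D.chart q) := by
    funext q
    ext i <;> simp [imComp, η, lam, L1, L2]
  refine ⟨V, hV, ⟨hp, Metric.mem_ball_self hr⟩, Set.inter_subset_left, η, lam, ?_, ?_, ?_⟩
  · exact fun i => ((L1 i).contMDiff.comp_contMDiffOn hes).sub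
      ((Complex.I • L1 i).contMDiff.comp_contMDiffOn hPe)
  · exact fun i => (((L2 i).contMDiff.comp_contMDiffOn hes).sub
      ((Complex.I • L2 i).contMDiff.comp_contMDiffOn hPe)).neg
  · intro q hq v
    have hed := D.mdifferentiable.mdifferentiableAt hq.1
    have hPd := (hPe.contMDiffAt (hV.mem_nhds hq)).mdifferentiableAt (by simp)
    have hneg := mdifferentiableAt_clm_comp
      (-ContinuousLinearMap.id ℝ ((Fin n → ℝ) × (Fin n → ℝ))) hPd
    have hneg' := mvfderiv_clm_comp
      (-ContinuousLinearMap.id ℝ ((Fin n → ℝ) × (Fin n → ℝ))) hPd v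
    refine (nablaC_symplecticSection_eq_piHol_iff D hq.1 (by rw [hre]; exact hed)
      (by rw [him]; exact hneg) v).2 ⟨by rw [hre]; rfl, ?_⟩
    rw [him]
    refine hneg'.trans ?_
    have h5 := mfderiv_comp_apply q (hP _ hq.2).differentiableAt.mdifferentiableAt hed v
    rw [mfderiv_eq_fderiv, (hP _ hq.2).fderiv] at h5
    exact congrArg (fun x => -x) (Eq.trans h5 (D.complexStructure_coordDeriv hq.1 v))

end Existence

end SpecialKahler

namespace SpecialKahler

variable {n : ℕ} {M : Type*} [TopologicalSpace M]

/-! ### Holomorphic charts, ranks and the prepotential. -/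

theorem IsPrepotential.fderiv_comp_symm {e : OpenPartialHomeomorph M (Fin n → ℂ)}
    {lam : Fin n → M → ℂ} {F : (Fin n → ℂ) → ℂ} (h : IsPrepotential e lam F)
    {w : Fin n → ℂ} (hw : w ∈ e.target) {j : Fin n}
    (hd : DifferentiableAt ℂ (fun w => lam j (e.symm w)) w) (u : Fin n → ℂ) :
    fderiv ℂ (fun w => lam j (e.symm w)) w u
      = -8 * fderiv ℂ (fun w => fderiv ℂ F w (Pi.single j 1)) w u := by
  have hev : (fun w => fderiv ℂ F w (Pi.single j 1)) =ᶠ[nhds w]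
      fun w => (-1 / 8 : ℂ) * lam j (e.symm w) := by
    filter_upwards [e.open_target.mem_nhds hw] with y hy
    rw [h.eq _ (e.map_target hy), e.right_inv hy]
    ring
  rw [hev.fderiv_eq, (hd.hasFDerivAt.const_mul _).fderiv]
  simp; ring

/-- All partial derivatives of `F`, hence `dF`, are prescribed by `lam`, and the domain is
connected. -/
theorem IsPrepotential.unique {e : OpenPartialHomeomorph M (Fin n → ℂ)}
    {lam : Fin n → M → ℂ} {F G : (Fin n → ℂ) → ℂ} (hF : IsPrepotential e lam F)
    (hG : IsPrepotential e lam G) (he : IsPreconnected e.target) :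
    ∃ c : ℂ, ∀ w ∈ e.target, G w = F w + c := by
  obtain ⟨c, hc⟩ := e.open_target.exists_is_const_of_fderiv_eq_zero (𝕜 := ℂ) he
    (hG.holomorphic.sub hF.holomorphic) (fun w hw => by
      have hm := e.open_target.mem_nhds hw
      rw [fderiv_sub (hG.holomorphic.differentiableAt hm) (hF.holomorphic.differentiableAt hm)]
      have : fderiv ℂ G w = fderiv ℂ F w := by
        apply ContinuousLinearMap.coe_injective
        refine LinearMap.pi_ext' fun j => LinearMap.ext_ring ?_
        have h1 := hF.eq _ (e.map_target hw) j
        have h2 := hG.eq _ (e.map_target hw) j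
        rw [e.right_inv hw] at h1 h2
        rw [h1] at h2
        exact (mul_left_cancel₀ (by norm_num) h2).symm
      rw [this, sub_self]; rfl)
  exact ⟨c, fun w hw => by rw [← hc w hw]; simp⟩

variable [ChartedSpace (Fin n → ℂ) M]

theorem mdifferentiable_of_mem_maximalAtlas {z : OpenPartialHomeomorph M (Fin n → ℂ)}
    (hz : z ∈ IsManifold.maximalAtlas 𝓘(ℂ, Fin n → ℂ) ω M) :
    z.MDifferentiable 𝓘(ℂ, Fin n → ℂ) 𝓘(ℂ, Fin n → ℂ) :=
  ⟨(contMDiffOn_of_mem_maximalAtlas hz).mdifferentiableOn (by simp),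
    (contMDiffOn_symm_of_mem_maximalAtlas hz).mdifferentiableOn (by simp)⟩

theorem injective_mfderiv_chart_symm {z : OpenPartialHomeomorph M (Fin n → ℂ)}
    (hz : z ∈ IsManifold.maximalAtlas 𝓘(ℂ, Fin n → ℂ) ω M) {w : Fin n → ℂ} (hw : w ∈ z.target) :
    Function.Injective (mfderiv 𝓘(ℂ, Fin n → ℂ) 𝓘(ℂ, Fin n → ℂ) z.symm w) :=
  ((mdifferentiable_of_mem_maximalAtlas hz).symm.mfderiv (x := w) hw).injective

theorem fderiv_comp_chart_symm {z : OpenPartialHomeomorph M (Fin n → ℂ)}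
    (hz : z ∈ IsManifold.maximalAtlas 𝓘(ℂ, Fin n → ℂ) ω M) {w : Fin n → ℂ} (hw : w ∈ z.target)
    {f : M → ℂ} (hf : MDifferentiableAt 𝓘(ℂ, Fin n → ℂ) 𝓘(ℂ, ℂ) f (z.symm w)) :
    DifferentiableAt ℂ (fun w => f (z.symm w)) w ∧
    ∀ u, fderiv ℂ (fun w => f (z.symm w)) w u = mvfderiv 𝓘(ℝ, Fin n → ℂ) f (z.symm w)
      (mfderiv 𝓘(ℂ, Fin n → ℂ) 𝓘(ℂ, Fin n → ℂ) z.symm w u) := by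
  have hs := (mdifferentiable_of_mem_maximalAtlas hz).mdifferentiableAt_symm hw
  refine ⟨(hf.comp w hs).differentiableAt, fun u => ?_⟩
  refine Eq.trans ?_ (mvfderiv_real_eq_complex hf _).symm
  rw [← mfderiv_eq_fderiv]
  exact mfderiv_comp_apply w hf hs u

theorem IsHolChart.fderiv_comp_symm {V : Set M} {f : Fin n → M → ℂ}
    {e : OpenPartialHomeomorph M (Fin n → ℂ)} (he : IsHolChart V f e) {w : Fin n → ℂ}
    (hw : w ∈ e.target) (j : Fin n) (u : Fin n → ℂ) :
    fderiv ℂ (fun w => f j (e.symm w)) w u = u j := by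
  have hev : (fun w => f j (e.symm w)) =ᶠ[nhds w] fun w => w j := by
    filter_upwards [e.open_target.mem_nhds hw] with y hy
    rw [← he.eq _ (e.map_target hy), e.right_inv hy]
  rw [hev.fderiv_eq]
  exact congrArg (fun T => T u) (ContinuousLinearMap.proj (R := ℂ) (φ := fun _ : Fin n => ℂ) j).fderiv

/-- A kernel vector of the Jacobian is carried by the injective differential of `z.symm` to a
tangent vector killed by every `df_j`; a square matrix with trivial kernel has full rank. -/
theorem rank_jacobian {z : OpenPartialHomeomorph M (Fin n → ℂ)}
    (hz : z ∈ IsManifold.maximalAtlas 𝓘(ℂ, Fin n → ℂ) ω M) {p : M} (hp : p ∈ z.source)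
    {f : Fin n → M → ℂ} (hf : ∀ j, MDifferentiableAt 𝓘(ℂ, Fin n → ℂ) 𝓘(ℂ, ℂ) (f j) p)
    (hinj : ∀ v, (∀ j, mvfderiv 𝓘(ℝ, Fin n → ℂ) (f j) p v = 0) → v = 0) :
    (jacobian z f p).rank = n := by
  obtain ⟨w, hw, rfl⟩ : ∃ w ∈ z.target, z.symm w = p := ⟨z p, z.map_source hp, z.left_inv hp⟩
  have hmul : ∀ u j, (jacobian z f (z.symm w)).mulVec u j
      = fderiv ℂ (fun w => f j (z.symm w)) w u := by
    intro u j
    conv_rhs => rw [pi_eq_sum_univ' u, map_sum]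
    simp only [Matrix.mulVec, dotProduct, jacobian, Matrix.of_apply, z.right_inv hw, map_smul,
      smul_eq_mul]
    exact Finset.sum_congr rfl fun l _ => mul_comm _ _
  rw [Matrix.rank_of_isUnit _ (Matrix.mulVec_injective_iff_isUnit.1 ?_), Fintype.card_fin]
  rw [← Matrix.coe_mulVecLin, injective_iff_map_eq_zero]
  intro u hu
  apply (injective_iff_map_eq_zero _).1 (injective_mfderiv_chart_symm hz hw) u
  refine hinj _ fun j => ?_
  rw [← (fderiv_comp_chart_symm hz hw (hf j)).2 u, ← hmul]
  exact congrFun hu j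

/-- Functions `lam` with `∑ dlam_j ∧ dη^j = 0` have a prepotential on a ball. -/
theorem exists_isPrepotential {V : Set M} (hV : IsOpen V) {η lam : Fin n → M → ℂ}
    {e : OpenPartialHomeomorph M (Fin n → ℂ)} (he : IsHolChart V η e)
    {c : Fin n → ℂ} {r : ℝ} (hball : e.target = Metric.ball c r)
    (hη : Holomorphic V η) (hlam : Holomorphic V lam)
    (hsymm : ∀ p ∈ V, ∀ u v : RTangent n p,
      ∑ j, mvfderiv 𝓘(ℝ, Fin n → ℂ) (lam j) p u * mvfderiv 𝓘(ℝ, Fin n → ℂ) (η j) p v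
        = ∑ j, mvfderiv 𝓘(ℝ, Fin n → ℂ) (lam j) p v * mvfderiv 𝓘(ℝ, Fin n → ℂ) (η j) p u) :
    ∃ F, IsPrepotential e lam F := by
  have hmd : ∀ {f : Fin n → M → ℂ}, Holomorphic V f → ∀ w ∈ e.target, ∀ j,
      MDifferentiableAt 𝓘(ℂ, Fin n → ℂ) 𝓘(ℂ, ℂ) (f j) (e.symm w) := fun hf w hw j =>
    have := he.subset (e.map_target hw)
    (hf j _ this).mdifferentiableAt (hV.mem_nhds this)
  let P : Fin n → (Fin n → ℂ) →L[ℂ] ℂ := fun j => ContinuousLinearMap.proj j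
  -- The 1-form `∑ λ_j dη^j`; in the chart `e` the coordinates are the `η^j`, so `dη^j` is the
  -- `j`-th projection.
  let θ : (Fin n → ℂ) → (Fin n → ℂ) →L[ℂ] ℂ := fun w => ∑ j, lam j (e.symm w) • P j
  have hθ : ∀ w ∈ e.target, HasFDerivAt θ
      (∑ j, (fderiv ℂ (fun w => lam j (e.symm w)) w).smulRight (P j)) w := by
    intro w hw
    refine HasFDerivAt.fun_sum fun j _ => ?_
    have h1 := (fderiv_comp_chart_symm he.mem_atlas hw (hmd hlam w hw j)).1.hasFDerivAt
    exact h1.smul_const (P j)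
  have hθd : DifferentiableOn ℝ θ (Metric.ball c r) := fun w hw =>
    ((hθ w (hball ▸ hw)).restrictScalars ℝ).differentiableAt.differentiableWithinAt
  obtain ⟨F, hF⟩ := (convex_ball c r).exists_forall_hasFDerivAt_of_fderiv_symmetric
    Metric.isOpen_ball hθd (by
      intro w hw x y
      have hw' : w ∈ e.target := hball ▸ hw
      rw [((hθ w hw').restrictScalars ℝ).fderiv]
      have h1 := hsymm _ (he.subset (e.map_target hw'))
        (mfderiv 𝓘(ℂ, Fin n → ℂ) 𝓘(ℂ, Fin n → ℂ) e.symm w x)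
        (mfderiv 𝓘(ℂ, Fin n → ℂ) 𝓘(ℂ, Fin n → ℂ) e.symm w y)
      -- With `dη^j(u) = u_j`, the vanishing of `∑ dλ_j ∧ dη^j` becomes symmetry of the derivative
      -- of `θ`.
      simp only [← (fderiv_comp_chart_symm he.mem_atlas hw' (hmd hlam w hw' _)).2,
        ← (fderiv_comp_chart_symm he.mem_atlas hw' (hmd hη w hw' _)).2,
        he.fderiv_comp_symm hw'] at h1
      simpa [P] using h1)
  rw [← hball] at hF
  refine ⟨fun w => (-1 / 8 : ℂ) * F w, fun w hw =>
    ((hF w hw).const_mul _).differentiableAt.differentiableWithinAt, fun q hq j => ?_⟩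
  rw [((hF _ (e.map_source hq)).const_mul _).fderiv]
  simp only [θ, P, e.left_inv hq, smul_apply, sum_apply,
    ContinuousLinearMap.proj_apply, smul_eq_mul]
  rw [Finset.sum_eq_single j]
  · simp; ring
  · intro i _ hij
    simp [Pi.single_eq_of_ne hij]
  · simp

variable [IsManifold 𝓘(ℂ, Fin n → ℂ) ω M]

/-- Holomorphic functions with independent differentials are local coordinates. -/
theorem exists_isHolChart {V : Set M} (hV : IsOpen V) {f : Fin n → M → ℂ}
    (hs : ∀ j, ContMDiffOn 𝓘(ℝ, Fin n → ℂ) 𝓘(ℝ, ℂ) ∞ (f j) V) (hc : Holomorphic V f)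
    (hinj : ∀ p ∈ V, ∀ v, (∀ j, mvfderiv 𝓘(ℝ, Fin n → ℂ) (f j) p v = 0) → v = 0)
    {p : M} (hp : p ∈ V) :
    ∃ e, IsHolChart V f e ∧ p ∈ e.source ∧ ∃ r > 0, e.target = Metric.ball (e p) r := by
  let φ := chartAt (Fin n → ℂ) p
  have hφ : φ ∈ IsManifold.maximalAtlas 𝓘(ℂ, Fin n → ℂ) ω M := IsManifold.chart_mem_maximalAtlas _
  have hφr : φ ∈ IsManifold.maximalAtlas 𝓘(ℝ, Fin n → ℂ) ω M := IsManifold.chart_mem_maximalAtlas _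
  have hpφ : p ∈ φ.source := mem_chart_source _ _
  let U : Set (Fin n → ℂ) := φ.target ∩ φ.symm ⁻¹' V
  have hU : IsOpen U := φ.isOpen_inter_preimage_symm hV
  have hpU : φ p ∈ U := ⟨φ.map_source hpφ, by simpa [φ.left_inv hpφ] using hp⟩
  let F : (Fin n → ℂ) → Fin n → ℂ := fun w j => f j (φ.symm w)
  have hd : ∀ w ∈ U, ∀ j, DifferentiableAt ℂ (fun w => f j (φ.symm w)) w := fun w hw j =>
    (fderiv_comp_chart_symm hφ hw.1 ((hc j _ hw.2).mdifferentiableAt (hV.mem_nhds hw.2))).1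
  have hF : ContDiffOn ℂ ω F U := by
    refine contDiffOn_pi.2 fun j => contDiffOn_omega_of_real hU ?_ fun w hw =>
      (hd w hw j).differentiableWithinAt
    rw [← contMDiffOn_iff_contDiffOn]
    exact (hs j).comp (((contMDiffOn_symm_of_mem_maximalAtlas hφr).of_le le_top).mono
      Set.inter_subset_left) fun w hw => hw.2
  have hF' : ∀ w ∈ U, ∃ L : (Fin n → ℂ) ≃L[ℂ] (Fin n → ℂ), HasFDerivAt F (L : _ →L[ℂ] _) w := by
    intro w hw
    have hFw : HasFDerivAt F (fderiv ℂ F w) w :=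
      ((hF.contDiffAt (hU.mem_nhds hw)).differentiableAt (by simp)).hasFDerivAt
    -- An injective endomorphism of `ℂⁿ` is invertible, so the inverse function theorem applies at
    -- every point of `U`.
    have hi : Function.Injective (fderiv ℂ F w).toLinearMap := by
      rw [injective_iff_map_eq_zero]
      intro u hu
      apply (injective_iff_map_eq_zero _).1 (injective_mfderiv_chart_symm hφ hw.1) u
      refine hinj _ hw.2 _ fun j => ?_
      rw [← (fderiv_comp_chart_symm hφ hw.1
        ((hc j _ hw.2).mdifferentiableAt (hV.mem_nhds hw.2))).2 u]
      have h1 := (hasFDerivAt_pi'.1 hFw j).fderiv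
      rw [h1]
      exact congrFun hu j
    refine ⟨(LinearEquiv.ofInjectiveEndo _ hi).toContinuousLinearEquiv, ?_⟩
    convert! hFw
  obtain ⟨L, hL⟩ := hF' _ hpU
  let h := ((hF.contDiffAt (hU.mem_nhds hpU)).toOpenPartialHomeomorph F hL (by simp)).restrOpen U hU
  have hh : ∀ w, h w = F w := fun _ => rfl
  have hhU : h.source ⊆ U := Set.inter_subset_right
  have hph : φ p ∈ h.source :=
    ⟨(hF.contDiffAt (hU.mem_nhds hpU)).mem_toOpenPartialHomeomorph_source hL (by simp), hpU⟩
  obtain ⟨r, hr, hball⟩ := Metric.isOpen_iff.1 h.open_target _ (h.map_source hph)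
  -- The local inverse is restricted to a ball, so that the image of the final chart is convex, as
  -- the Poincaré lemma and connectedness require.
  let k := (h.symm.restrOpen (Metric.ball (h (φ p)) r) Metric.isOpen_ball).symm
  have hk : ∀ w, k w = F w := fun _ => rfl
  have hkt : k.target = Metric.ball (h (φ p)) r := Set.inter_eq_right.2 hball
  have hksymm : ∀ y ∈ k.target, k.symm y ∈ h.source := fun y hy => h.map_target (hball (hkt ▸ hy))
  have hks : k.source ⊆ U := fun w hw => by
    rw [← k.left_inv hw]
    exact hhU (hksymm _ (k.map_source hw))
  have hpk : φ p ∈ k.source := by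
    have h1 : F (φ p) ∈ k.target := hkt ▸ Metric.mem_ball_self hr
    have h2 := k.map_target h1
    have h3 : k.symm (F (φ p)) = φ p := h.left_inv hph
    rwa [h3] at h2
  have hkF : ContDiffOn ℂ ω k k.source := hF.mono hks
  -- Invertibility of the derivative on all of `U`, not only at the centre, makes the inverse
  -- analytic on its whole domain.
  have hkF' : ContDiffOn ℂ ω k.symm k.target := fun y hy => by
    have hyU := hks (k.map_target hy)
    obtain ⟨L, hL⟩ := hF' _ hyU
    exact (k.contDiffAt_symm hy hL (hF.contDiffAt (hU.mem_nhds hyU))).contDiffWithinAt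
  let e := φ.trans k
  have hes : e.source ⊆ φ.source := fun q hq => hq.1
  have hek : ∀ q ∈ e.source, φ q ∈ k.source := fun q hq => hq.2
  have het : e.target = k.target := by
    refine Set.inter_eq_left.2 fun y hy => (hks (k.map_target hy)).1
  refine ⟨e, ⟨?_, ?_, ?_⟩, ⟨hpφ, hpk⟩, r, hr, ?_⟩
  · refine e.mem_maximalAtlas_of_contMDiffOn ?_ ?_
    · exact hkF.contMDiffOn.comp ((contMDiffOn_of_mem_maximalAtlas hφ).mono hes) hek
    · rw [het]
      exact (contMDiffOn_symm_of_mem_maximalAtlas hφ).comp hkF'.contMDiffOn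
        fun y hy => (hks (k.map_target hy)).1
  · intro q hq
    have := (hks (hek q hq)).2
    rwa [Set.mem_preimage, φ.left_inv (hes hq)] at this
  · intro q hq j
    change f j (φ.symm (φ q)) = f j q
    rw [φ.left_inv (hes hq)]
  · rw [het, hkt]; rfl

theorem IsSpecialPair.holomorphic {K : KahlerMetric n M} {S : SpecialStructure K}
    {D : FlatDarboux S} {V : Set M} {η lam : Fin n → M → ℂ} (h : IsSpecialPair D V η lam)
    (hV : IsOpen V) (hVD : V ⊆ D.chart.source) : Holomorphic V η ∧ Holomorphic V lam := by
  refine ⟨fun j p hp => ?_, fun j p hp => ?_⟩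
  · exact (mdifferentiableAt_complex_of_mvfderiv_J
      (((h.smooth_eta j).contMDiffAt (hV.mem_nhds hp)).mdifferentiableAt (by simp))
      fun v => (h.mvfderiv_J hV hVD hp v j).1).mdifferentiableWithinAt
  · exact (mdifferentiableAt_complex_of_mvfderiv_J
      (((h.smooth_lam j).contMDiffAt (hV.mem_nhds hp)).mdifferentiableAt (by simp))
      fun v => (h.mvfderiv_J hV hVD hp v j).2).mdifferentiableWithinAt

end SpecialKahler

end

/-! ### The main theorem. -/

theorem mainTheorem5 {n : ℕ} {M : Type*} [TopologicalSpace M] [ChartedSpace (Fin n → ℂ) M]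
    [IsManifold 𝓘(ℂ, Fin n → ℂ) ω M]
    (K : SpecialKahler.KahlerMetric n M) (S : SpecialKahler.SpecialStructure K)
    (D : SpecialKahler.FlatDarboux S) :
    -- `η, lam` exist around each point of the domain of the flat Darboux system
    (∀ p ∈ D.chart.source, ∃ V : Set M, IsOpen V ∧ p ∈ V ∧ V ⊆ D.chart.source ∧
      ∃ η lam : Fin n → M → ℂ, SpecialKahler.IsSpecialPair D V η lam) ∧
    ∀ (V : Set M) (η lam : Fin n → M → ℂ), IsOpen V → V ⊆ D.chart.source →
      SpecialKahler.IsSpecialPair D V η lam →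
      (SpecialKahler.Holomorphic V η ∧ SpecialKahler.Holomorphic V lam) ∧
      -- the matrices `α` and `β` have rank `n` in all holomorphic coordinates `z`
      (∀ z ∈ IsManifold.maximalAtlas 𝓘(ℂ, Fin n → ℂ) ω M, ∀ p ∈ V ∩ z.source,
        (SpecialKahler.jacobian z η p).rank = n ∧ (SpecialKahler.jacobian z lam p).rank = n) ∧
      SpecialKahler.AreHolCoordinates V η ∧ SpecialKahler.AreHolCoordinates V lam ∧
      -- the prepotential, unique up to a constant, around each point
      (∀ p ∈ V, ∃ e, SpecialKahler.IsHolChart V η e ∧ p ∈ e.source ∧ IsConnected e.source ∧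
        ∃ F : (Fin n → ℂ) → ℂ, SpecialKahler.IsPrepotential e lam F ∧
          (∀ q ∈ e.source, ∀ i j,
            fderiv ℂ (fun w => lam j (e.symm w)) (e q) (Pi.single i 1)
              = -8 * fderiv ℂ (fun w => fderiv ℂ F w (Pi.single j 1)) (e q) (Pi.single i 1)) ∧
          ∀ G : (Fin n → ℂ) → ℂ, SpecialKahler.IsPrepotential e lam G →
            ∃ c : ℂ, ∀ w ∈ e.target, G w = F w + c) := by

  refine ⟨fun p hp => D.exists_isSpecialPair hp, fun V η lam hV hVD h => ?_⟩
  obtain ⟨hη, hlam⟩ := h.holomorphic hV hVD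
  have hiη := fun p hp => h.eq_zero_of_mvfderiv_eta hV hVD (p := p) hp
  have hilam := fun p hp => h.eq_zero_of_mvfderiv_lam hV hVD (p := p) hp
  refine ⟨⟨hη, hlam⟩, fun z hz p hp => ⟨?_, ?_⟩, fun p hp => ?_, fun p hp => ?_, fun p hp => ?_⟩
  · exact SpecialKahler.rank_jacobian hz hp.2
      (fun j => (hη j p hp.1).mdifferentiableAt (hV.mem_nhds hp.1)) (hiη p hp.1)
  · exact SpecialKahler.rank_jacobian hz hp.2
      (fun j => (hlam j p hp.1).mdifferentiableAt (hV.mem_nhds hp.1)) (hilam p hp.1)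
  · obtain ⟨e, he, hpe, -⟩ := SpecialKahler.exists_isHolChart hV h.smooth_eta hη hiη hp
    exact ⟨e, he, hpe⟩
  · obtain ⟨e, he, hpe, -⟩ := SpecialKahler.exists_isHolChart hV h.smooth_lam hlam hilam hp
    exact ⟨e, he, hpe⟩
  · obtain ⟨e, he, hpe, r, hr, hball⟩ :=
      SpecialKahler.exists_isHolChart hV h.smooth_eta hη hiη hp
    obtain ⟨F, hF⟩ := SpecialKahler.exists_isPrepotential hV he hball hη hlam
      fun q hq => h.sum_wedge_eq_zero hV hVD hq
    -- The target is a nonempty ball; its connectedness gives uniqueness of `F` up to a constant and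
    -- passes to the source through the inverse chart.
    have hconn : IsConnected e.target := by
      rw [hball]
      exact (convex_ball _ _).isConnected (Metric.nonempty_ball.2 hr)
    refine ⟨e, he, hpe, ?_, F, hF, fun q hq i j => ?_,
      fun G hG => hF.unique hG hconn.isPreconnected⟩
    · rw [← e.symm_image_target_eq_source]
      exact hconn.image _ e.continuousOn_symm
    · refine hF.fderiv_comp_symm (e.map_source hq)
        (SpecialKahler.fderiv_comp_chart_symm he.mem_atlas (e.map_source hq) ?_).1 _
      rw [e.left_inv hq]
      exact (hlam j q (he.subset hq)).mdifferentiableAt (hV.mem_nhds (he.subset hq))
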